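/- Let $M$ be a smooth manifold and let $\mathcal G$ be a Lie groupoid over $M$ with source $s$, target $t$ and unit map $e\colon M\to\mathcal G$, where the product $\gamma h$ is defined when $s(\gamma)=t(h)$. (Manifolds are finite-dimensional and without boundary; $M$ is Hausdorff and second countable, while $\mathcal G$ need not be.) Assume that $\mathcal G$ carries a Riemannian metric $\eta$ such that $s\colon(\mathcal G,\eta)\to(M,g)$ and $t\colon(\mathcal G,\eta)\to(M,g')$ are Riemannian submersions for some Riemannian metrics $g$ and $g'$ on $M$, which need not coincide. Let $A\to M$ be the vector bundle with fibres $A_x=\ker(\mathrm dt)_{e(x)}\subset T_{e(x)}\mathcal G$. A section $\sigma$ of $A$ is identified with the left invariant $t$-vertical vector field $\gamma\mapsto \mathrm d L_\gamma\,\sigma(s(\gamma))$ on $\mathcal G$. Then $A$, with the anchor $\rho=\mathrm ds|_A$ and the Lie bracket of left invariant $t$-vertical vector fields, is a Lie algebroid over $M$ (the Lie algebroid of $\mathcal G$), and there is a smooth connection $\nabla$ on $A$ such that $(A,\nabla,g)$ is a Killing Lie algebroid, i.e. ${}^\tau\nabla g=0$, where ${}^\tau\nabla_\sigma X=[\rho(\sigma),X]+\rho(\nabla_X\sigma)$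 for $\sigma\in\Gamma(A)$ and $X\in\Gamma(TM)$. Explicitly, for all $\sigma\in\Gamma(A)$ and $X,Y\in\Gamma(TM)$, $$\rho(\sigma)\big(g(X,Y)\big)=g\big([\rho(\sigma),X]+\rho(\nabla_X\sigma),\,Y\big)+g\big(X,\,[\rho(\sigma),Y]+\rho(\nabla_Y\sigma)\big).$$ -/

import Mathlib

open Bundle Set
open scoped Manifold ContDiff Topology

noncomputable section

variable (EM EG : Type*) [NormedAddCommGroup EM] [NormedSpace ℝ EM]
  [NormedAddCommGroup EG] [NormedSpace ℝ EG]
  (M G : Type*) [TopologicalSpace M] [ChartedSpace EM M] [TopologicalSpace G] [ChartedSpace EG G]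

/-- A Lie groupoid `G` over `M`. Elements `γ` and `h` are composable if `s γ = t h`, and then
`mul γ h` is their product; the values of `mul` on other pairs carry no information. The composable
pairs form an embedded submanifold of `G × G`, and `ContMDiffOn` on it is smoothness of the
multiplication as a map on that submanifold. The total space `G` need not be Hausdorff. -/
structure LieGroupoid where
  /-- The source map. -/
  s : G → M
  /-- The target map. -/
  t : G → M
  /-- The unit bisection. -/
  e : M → G
  /-- The inverse. -/
  inv : G → G
  /-- The product `mul γ h = γ h`, for `s γ = t h`. -/
  mul : G → G → G
  contMDiff_s : ContMDiff 𝓘(ℝ, EG) 𝓘(ℝ, EM) ∞ s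
  contMDiff_t : ContMDiff 𝓘(ℝ, EG) 𝓘(ℝ, EM) ∞ t
  contMDiff_e : ContMDiff 𝓘(ℝ, EM) 𝓘(ℝ, EG) ∞ e
  contMDiff_inv : ContMDiff 𝓘(ℝ, EG) 𝓘(ℝ, EG) ∞ inv
  contMDiffOn_mul : ContMDiffOn (𝓘(ℝ, EG).prod 𝓘(ℝ, EG)) 𝓘(ℝ, EG) ∞
    (fun p : G × G => mul p.1 p.2) {p : G × G | s p.1 = t p.2}
  surjective_mfderiv_s : ∀ γ : G, Function.Surjective (mfderiv 𝓘(ℝ, EG) 𝓘(ℝ, EM) s γ)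
  surjective_mfderiv_t : ∀ γ : G, Function.Surjective (mfderiv 𝓘(ℝ, EG) 𝓘(ℝ, EM) t γ)
  s_e : ∀ x : M, s (e x) = x
  t_e : ∀ x : M, t (e x) = x
  s_mul : ∀ γ h : G, s γ = t h → s (mul γ h) = s h
  t_mul : ∀ γ h : G, s γ = t h → t (mul γ h) = t γ
  mul_assoc : ∀ γ h k : G, s γ = t h → s h = t k → mul (mul γ h) k = mul γ (mul h k)
  e_mul : ∀ γ : G, mul (e (t γ)) γ = γ
  mul_e : ∀ γ : G, mul γ (e (s γ)) = γ
  s_inv : ∀ γ : G, s (inv γ) = t γ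
  t_inv : ∀ γ : G, t (inv γ) = s γ
  inv_mul : ∀ γ : G, mul (inv γ) γ = e (s γ)
  mul_inv : ∀ γ : G, mul γ (inv γ) = e (t γ)

namespace LieGroupoid

variable {EM EG M G}
variable (𝒢 : LieGroupoid EM EG M G)

/-- The space `ker dt` at the unit `e x`. -/
abbrev kerT (x : M) : Submodule ℝ (TangentSpace 𝓘(ℝ, EG) (𝒢.e x)) :=
  LinearMap.ker (mfderiv 𝓘(ℝ, EG) 𝓘(ℝ, EM) 𝒢.t (𝒢.e x)).toLinearMap

/-- The fibre at `x` of the Lie algebroid of `𝒢`: the tangent space at `e x` of the `t`-fibre. -/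
abbrev AlgebroidFiber (x : M) : Type _ := 𝒢.kerT x

variable (EM EG) in
/-- The model fibre of the Lie algebroid, of dimension `dim G - dim M`. -/
abbrev AlgebroidModel : Type :=
  EuclideanSpace ℝ (Fin (Module.finrank ℝ EG - Module.finrank ℝ EM))

variable [IsManifold 𝓘(ℝ, EM) ∞ M] [IsManifold 𝓘(ℝ, EG) ∞ G]

/-- The preferred trivialization of `TG` around `e x₀`. -/
abbrev trivG (x₀ : M) : Trivialization EG (π EG (TangentSpace 𝓘(ℝ, EG) : G → Type _)) :=
  trivializationAt EG (TangentSpace 𝓘(ℝ, EG) : G → Type _) (𝒢.e x₀)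

/-- The preferred trivialization of `TM` around `x₀`. -/
abbrev trivM (x₀ : M) : Trivialization EM (π EM (TangentSpace 𝓘(ℝ, EM) : M → Type _)) :=
  trivializationAt EM (TangentSpace 𝓘(ℝ, EM) : M → Type _) x₀

/-- The differential of `t` at `e x`, read in the trivializations around `x₀`. -/
def diffT (x₀ x : M) : EG →L[ℝ] EM :=
  ((trivM (EM := EM) x₀).continuousLinearMapAt ℝ (𝒢.t (𝒢.e x))).comp
    ((mfderiv 𝓘(ℝ, EG) 𝓘(ℝ, EM) 𝒢.t (𝒢.e x)).comp ((𝒢.trivG x₀).symmL ℝ (𝒢.e x)))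

/-- The points `x` at which both trivializations around `x₀` can be used. -/
def domT (x₀ : M) : Set M :=
  {x | x ∈ (trivM (EM := EM) x₀).baseSet ∧ 𝒢.e x ∈ (𝒢.trivG x₀).baseSet}

theorem isOpen_domT (x₀ : M) : IsOpen (𝒢.domT x₀) :=
  (trivM (EM := EM) x₀).open_baseSet.inter
    ((𝒢.trivG x₀).open_baseSet.preimage 𝒢.contMDiff_e.continuous)

theorem mem_domT (x₀ : M) : x₀ ∈ 𝒢.domT x₀ :=
  ⟨mem_baseSet_trivializationAt _ _ _, mem_baseSet_trivializationAt _ _ _⟩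

theorem diffT_apply {x₀ x : M} (hx : x ∈ 𝒢.domT x₀) (w : EG) :
    𝒢.diffT x₀ x w =
      (trivM (EM := EM) x₀ (tangentMap 𝓘(ℝ, EG) 𝓘(ℝ, EM) 𝒢.t
        ((𝒢.trivG x₀).toOpenPartialHomeomorph.symm (𝒢.e x, w)))).2 := by
  have h1 : 𝒢.t (𝒢.e x) ∈ (trivM (EM := EM) x₀).baseSet := by rw [𝒢.t_e]; exact hx.1
  have h2 : (𝒢.trivG x₀).toOpenPartialHomeomorph.symm (𝒢.e x, w)
      = ⟨𝒢.e x, (𝒢.trivG x₀).symm (𝒢.e x) w⟩ :=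
    ((𝒢.trivG x₀).mk_symm hx.2 w).symm
  rw [h2]
  simp only [diffT, tangentMap, ContinuousLinearMap.comp_apply]
  rw [Trivialization.continuousLinearMapAt_apply_of_mem (R := ℝ) _ h1,
    Trivialization.symmL_apply _ hx.2]

theorem contMDiffOn_diffT [FiniteDimensional ℝ EG] (x₀ : M) :
    ContMDiffOn 𝓘(ℝ, EM) 𝓘(ℝ, EG →L[ℝ] EM) ∞ (𝒢.diffT x₀) (𝒢.domT x₀) := by
  have key : ∀ w : EG, ContMDiffOn 𝓘(ℝ, EM) 𝓘(ℝ, EM) ∞ (fun x => 𝒢.diffT x₀ x w) (𝒢.domT x₀) := by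
    intro w
    have a1 : ContMDiffOn 𝓘(ℝ, EM) (𝓘(ℝ, EG).prod 𝓘(ℝ, EG)) ∞
        (fun x => (𝒢.trivG x₀).toOpenPartialHomeomorph.symm (𝒢.e x, w)) (𝒢.domT x₀) :=
      ((𝒢.trivG x₀).contMDiffOn_symm (IB := 𝓘(ℝ, EG)) (n := ∞)).comp
        (𝒢.contMDiff_e.prodMk contMDiff_const).contMDiffOn
        (fun x hx => ((𝒢.trivG x₀).mem_target).2 hx.2)
    have a2 := (𝒢.contMDiff_t.contMDiff_tangentMap (m := ∞) le_rfl).comp_contMDiffOn a1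
    have a3 := ((trivM (EM := EM) x₀).contMDiffOn (IB := 𝓘(ℝ, EM)) (n := ∞)).comp a2 (by
      intro x hx
      have h2 : (𝒢.trivG x₀).toOpenPartialHomeomorph.symm (𝒢.e x, w)
          = ⟨𝒢.e x, (𝒢.trivG x₀).symm (𝒢.e x) w⟩ :=
        ((𝒢.trivG x₀).mk_symm hx.2 w).symm
      rw [mem_preimage, Trivialization.mem_source, Function.comp_apply, h2]
      change 𝒢.t (𝒢.e x) ∈ _
      rw [𝒢.t_e]; exact hx.1)
    exact (contMDiff_snd.comp_contMDiffOn a3).congr fun x hx => 𝒢.diffT_apply hx w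
  let b := Module.finBasis ℝ EG
  have hsum : ∀ x, 𝒢.diffT x₀ x = ∑ i, ContinuousLinearMap.smulRightL ℝ EG EM
      (LinearMap.toContinuousLinearMap (b.coord i)) (𝒢.diffT x₀ x (b i)) := by
    intro x
    ext w
    conv_lhs => rw [← b.sum_repr w, map_sum]
    simp
  rw [show 𝒢.diffT x₀ = fun x => ∑ i, ContinuousLinearMap.smulRightL ℝ EG EM
      (LinearMap.toContinuousLinearMap (b.coord i)) (𝒢.diffT x₀ x (b i)) from funext hsum]
  refine contMDiffOn_finsetSum fun i _ => ?_
  exact (ContinuousLinearMap.contMDiff _).comp_contMDiffOn (key (b i))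

theorem surjective_diffT (x₀ : M) : Function.Surjective (𝒢.diffT x₀ x₀) := by
  have hx := 𝒢.mem_domT x₀
  have h1 : 𝒢.t (𝒢.e x₀) ∈ (trivM (EM := EM) x₀).baseSet := by rw [𝒢.t_e]; exact hx.1
  have hM : Function.Surjective
      ((trivM (EM := EM) x₀).continuousLinearMapAt ℝ (𝒢.t (𝒢.e x₀))) := fun w =>
    ⟨_, (trivM (EM := EM) x₀).continuousLinearMapAt_symmL (R := ℝ) h1 w⟩
  have hG : Function.Surjective ((𝒢.trivG x₀).symmL ℝ (𝒢.e x₀)) := fun w =>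
    ⟨_, (𝒢.trivG x₀).symmL_continuousLinearMapAt (R := ℝ) hx.2 w⟩
  exact hM.comp ((𝒢.surjective_mfderiv_t _).comp hG)

variable [FiniteDimensional ℝ EM] [FiniteDimensional ℝ EG]

theorem exists_complement (L : EG →L[ℝ] EM) (hL : Function.Surjective L) :
    ∃ P : EG →L[ℝ] AlgebroidModel EM EG,
      L.prod P ∈ range ((↑) : (EG ≃L[ℝ] EM × AlgebroidModel EM EG) → _) := by
  have hr := L.toLinearMap.finrank_range_add_finrank_ker
  rw [LinearMap.range_eq_top.2 hL, finrank_top] at hr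
  have hk : Module.finrank ℝ (LinearMap.ker L.toLinearMap) =
      Module.finrank ℝ (AlgebroidModel EM EG) := by
    rw [finrank_euclideanSpace_fin]; omega
  let φ := LinearEquiv.ofFinrankEq _ _ hk
  obtain ⟨p, hp⟩ := (LinearMap.ker L.toLinearMap).subtype.exists_leftInverse_of_injective
    (Submodule.ker_subtype _)
  let P : EG →L[ℝ] AlgebroidModel EM EG := LinearMap.toContinuousLinearMap (φ.toLinearMap.comp p)
  refine ⟨P, ?_⟩
  have hinj : Function.Injective (L.prod P).toLinearMap := by
    rw [← LinearMap.ker_eq_bot, LinearMap.ker_eq_bot']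
    intro v hv
    have h1 : L v = 0 := congrArg Prod.fst hv
    have h2 : φ (p v) = 0 := congrArg Prod.snd hv
    have h3 : p v = 0 := by simpa using h2
    have h4 : p v = ⟨v, h1⟩ := LinearMap.congr_fun hp ⟨v, h1⟩
    rw [h4] at h3
    exact congrArg Subtype.val h3
  have hfr : Module.finrank ℝ EG = Module.finrank ℝ (EM × AlgebroidModel EM EG) := by
    rw [Module.finrank_prod, finrank_euclideanSpace_fin]; omega
  refine ⟨(LinearEquiv.ofInjectiveOfFinrankEq _ hinj hfr).toContinuousLinearEquiv, ?_⟩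
  ext v <;> rfl

/-- A projection of `EG` that restricts to an isomorphism on the kernel of `diffT x₀ x₀`. -/
def complProj (x₀ : M) : EG →L[ℝ] AlgebroidModel EM EG :=
  (exists_complement (𝒢.diffT x₀ x₀) (𝒢.surjective_diffT x₀)).choose

/-- The map `(dt, complProj x₀)` at `e x`, read in the trivializations around `x₀`. -/
def splitT (x₀ x : M) : EG →L[ℝ] EM × AlgebroidModel EM EG :=
  (𝒢.diffT x₀ x).prod (𝒢.complProj x₀)

/-- The open neighbourhood of `x₀` on which `splitT x₀` is invertible. -/
def trivDomain (x₀ : M) : Set M :=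
  𝒢.domT x₀ ∩ 𝒢.splitT x₀ ⁻¹' range ((↑) : (EG ≃L[ℝ] EM × AlgebroidModel EM EG) → _)

theorem mem_trivDomain (x₀ : M) : x₀ ∈ 𝒢.trivDomain x₀ :=
  ⟨𝒢.mem_domT x₀, (exists_complement (𝒢.diffT x₀ x₀) (𝒢.surjective_diffT x₀)).choose_spec⟩

theorem contMDiffOn_splitT (x₀ : M) :
    ContMDiffOn 𝓘(ℝ, EM) 𝓘(ℝ, EG →L[ℝ] EM × AlgebroidModel EM EG) ∞ (𝒢.splitT x₀)
      (𝒢.domT x₀) := by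
  have h : ContDiff ℝ ∞ (fun L : EG →L[ℝ] EM => L.prod (𝒢.complProj x₀)) :=
    (ContinuousLinearMap.prodₗᵢ (𝕜 := ℝ) (E := EG) (F := EM) (G := AlgebroidModel EM EG)
      ℝ).contDiff.comp (contDiff_id.prodMk contDiff_const)
  exact h.contMDiff.comp_contMDiffOn (𝒢.contMDiffOn_diffT x₀)

theorem isOpen_trivDomain (x₀ : M) : IsOpen (𝒢.trivDomain x₀) :=
  (𝒢.contMDiffOn_splitT x₀).continuousOn.isOpen_inter_preimage (𝒢.isOpen_domT x₀)
    ContinuousLinearEquiv.isOpen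

theorem splitT_inverse_apply {x₀ x : M} (hx : x ∈ 𝒢.trivDomain x₀) (v : EG) :
    (𝒢.splitT x₀ x).inverse (𝒢.splitT x₀ x v) = v := by
  obtain ⟨E, hE⟩ := hx.2
  rw [← hE]; simp

theorem splitT_apply_inverse {x₀ x : M} (hx : x ∈ 𝒢.trivDomain x₀)
    (w : EM × AlgebroidModel EM EG) :
    𝒢.splitT x₀ x ((𝒢.splitT x₀ x).inverse w) = w := by
  obtain ⟨E, hE⟩ := hx.2
  rw [← hE]; simp

/-- Linear coordinates around `x₀` on the fibres of the Lie algebroid. -/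
def fiberCoord (x₀ x : M) : 𝒢.AlgebroidFiber x →L[ℝ] AlgebroidModel EM EG :=
  (𝒢.complProj x₀).comp (((𝒢.trivG x₀).continuousLinearMapAt ℝ (𝒢.e x)).comp
    (Submodule.subtypeL _))

/-- The vector of `ker dt` with given coordinates. -/
def fiberVec (x₀ x : M) : AlgebroidModel EM EG →L[ℝ] TangentSpace 𝓘(ℝ, EG) (𝒢.e x) :=
  ((𝒢.trivG x₀).symmL ℝ (𝒢.e x)).comp ((𝒢.splitT x₀ x).inverse.comp
    (ContinuousLinearMap.inr ℝ EM (AlgebroidModel EM EG)))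

theorem fiberVec_mem {x₀ x : M} (hx : x ∈ 𝒢.trivDomain x₀) (w : AlgebroidModel EM EG) :
    𝒢.fiberVec x₀ x w ∈ 𝒢.kerT x := by
  have h1 : 𝒢.t (𝒢.e x) ∈ (trivM (EM := EM) x₀).baseSet := by rw [𝒢.t_e]; exact hx.1.1
  have h := congrArg Prod.fst (𝒢.splitT_apply_inverse hx (0, w))
  have h2 : (trivM (EM := EM) x₀).continuousLinearMapAt ℝ (𝒢.t (𝒢.e x))
      (mfderiv 𝓘(ℝ, EG) 𝓘(ℝ, EM) 𝒢.t (𝒢.e x) (𝒢.fiberVec x₀ x w)) = 0 := h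
  have h3 := congrArg ((trivM (EM := EM) x₀).symmL ℝ (𝒢.t (𝒢.e x))) h2
  rw [Trivialization.symmL_continuousLinearMapAt _ h1, map_zero] at h3
  exact h3

theorem fiberCoord_fiberVec {x₀ x : M} (hx : x ∈ 𝒢.trivDomain x₀) (w : AlgebroidModel EM EG) :
    𝒢.fiberCoord x₀ x ⟨𝒢.fiberVec x₀ x w, 𝒢.fiberVec_mem hx w⟩ = w := by
  have h := congrArg Prod.snd (𝒢.splitT_apply_inverse hx (0, w))
  simp only [fiberCoord, fiberVec, ContinuousLinearMap.comp_apply, Submodule.subtypeL_apply]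
  rw [Trivialization.continuousLinearMapAt_symmL _ hx.1.2]
  exact h

theorem fiberVec_fiberCoord {x₀ x : M} (hx : x ∈ 𝒢.trivDomain x₀) (v : 𝒢.AlgebroidFiber x) :
    𝒢.fiberVec x₀ x (𝒢.fiberCoord x₀ x v) = v := by
  have h0 : 𝒢.splitT x₀ x ((𝒢.trivG x₀).continuousLinearMapAt ℝ (𝒢.e x) v) =
      (0, 𝒢.fiberCoord x₀ x v) := by
    refine Prod.ext ?_ rfl
    change (trivM (EM := EM) x₀).continuousLinearMapAt ℝ (𝒢.t (𝒢.e x))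
      (mfderiv 𝓘(ℝ, EG) 𝓘(ℝ, EM) 𝒢.t (𝒢.e x) ((𝒢.trivG x₀).symmL ℝ (𝒢.e x)
        ((𝒢.trivG x₀).continuousLinearMapAt ℝ (𝒢.e x) v))) = 0
    rw [Trivialization.symmL_continuousLinearMapAt _ hx.1.2]
    have hv : mfderiv 𝓘(ℝ, EG) 𝓘(ℝ, EM) 𝒢.t (𝒢.e x) v = 0 := v.2
    rw [hv, map_zero]
  simp only [fiberVec, ContinuousLinearMap.comp_apply, ContinuousLinearMap.inr_apply]
  rw [← h0, 𝒢.splitT_inverse_apply hx, Trivialization.symmL_continuousLinearMapAt _ hx.1.2]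

open Classical in
/-- The local trivialization around `x₀` of the bundle `x ↦ ker dt` at `e x`. -/
def algebroidTriv (x₀ : M) : Pretrivialization (AlgebroidModel EM EG)
    (π (AlgebroidModel EM EG) 𝒢.AlgebroidFiber) where
  toFun v := (v.1, 𝒢.fiberCoord x₀ v.1 v.2)
  invFun p := if h : p.1 ∈ 𝒢.trivDomain x₀ then
    ⟨p.1, ⟨𝒢.fiberVec x₀ p.1 p.2, 𝒢.fiberVec_mem h p.2⟩⟩ else ⟨p.1, 0⟩
  source := π (AlgebroidModel EM EG) 𝒢.AlgebroidFiber ⁻¹' 𝒢.trivDomain x₀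
  target := 𝒢.trivDomain x₀ ×ˢ univ
  map_source' v hv := ⟨hv, mem_univ _⟩
  map_target' p hp := by
    rw [dif_pos hp.1]; exact hp.1
  left_inv' v hv := by
    have hv' : v.1 ∈ 𝒢.trivDomain x₀ := hv
    rw [dif_pos hv']
    obtain ⟨x, v⟩ := v
    congr 1
    exact Subtype.ext (𝒢.fiberVec_fiberCoord hv' v)
  right_inv' p hp := by
    rw [dif_pos hp.1]
    exact Prod.ext rfl (𝒢.fiberCoord_fiberVec hp.1 p.2)
  open_target := (𝒢.isOpen_trivDomain x₀).prod isOpen_univ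
  baseSet := 𝒢.trivDomain x₀
  open_baseSet := 𝒢.isOpen_trivDomain x₀
  source_eq := rfl
  target_eq := rfl
  proj_toFun _ _ := rfl

instance (x₀ : M) : (𝒢.algebroidTriv x₀).IsLinear ℝ where
  linear _ _ := ⟨(𝒢.fiberCoord x₀ _).map_add, (𝒢.fiberCoord x₀ _).map_smul⟩

theorem algebroidTriv_symm {x₀ x : M} (hx : x ∈ 𝒢.trivDomain x₀) (w : AlgebroidModel EM EG) :
    (𝒢.algebroidTriv x₀).symm x w = ⟨𝒢.fiberVec x₀ x w, 𝒢.fiberVec_mem hx w⟩ := by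
  have h : (𝒢.algebroidTriv x₀).toPartialEquiv.symm (x, w) =
      ⟨x, ⟨𝒢.fiberVec x₀ x w, 𝒢.fiberVec_mem hx w⟩⟩ := dif_pos (show (x, w).1 ∈ _ from hx)
  have h2 := (𝒢.algebroidTriv x₀).mk_symm (b := x) hx w
  rw [h] at h2
  simpa using h2

/-- The transition functions of the Lie algebroid. -/
def algebroidCoordChange (x₀ x₁ x : M) : AlgebroidModel EM EG →L[ℝ] AlgebroidModel EM EG :=
  (𝒢.complProj x₁).comp ((((𝒢.trivG x₀).coordChangeL ℝ (𝒢.trivG x₁) (𝒢.e x) :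
    EG ≃L[ℝ] EG) : EG →L[ℝ] EG).comp ((𝒢.splitT x₀ x).inverse.comp
    (ContinuousLinearMap.inr ℝ EM (AlgebroidModel EM EG))))

theorem algebroidCoordChange_apply {x₀ x₁ x : M}
    (hx : x ∈ 𝒢.trivDomain x₀ ∩ 𝒢.trivDomain x₁) (w : AlgebroidModel EM EG) :
    𝒢.algebroidCoordChange x₀ x₁ x w =
      (𝒢.algebroidTriv x₁ ⟨x, (𝒢.algebroidTriv x₀).symm x w⟩).2 := by
  rw [𝒢.algebroidTriv_symm hx.1]
  change _ = 𝒢.fiberCoord x₁ x _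
  simp only [algebroidCoordChange, fiberCoord, fiberVec, ContinuousLinearMap.comp_apply,
    Submodule.subtypeL_apply, ContinuousLinearEquiv.coe_coe]
  rw [Trivialization.coordChangeL_apply _ _ ⟨hx.1.1.2, hx.2.1.2⟩,
    Trivialization.continuousLinearMapAt_apply_of_mem (R := ℝ) _ hx.2.1.2,
    Trivialization.symmL_apply _ hx.1.1.2]

theorem contMDiffOn_algebroidCoordChange (x₀ x₁ : M) :
    ContMDiffOn 𝓘(ℝ, EM) 𝓘(ℝ, AlgebroidModel EM EG →L[ℝ] AlgebroidModel EM EG) ∞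
      (𝒢.algebroidCoordChange x₀ x₁) (𝒢.trivDomain x₀ ∩ 𝒢.trivDomain x₁) := by
  have h1 : ContMDiffOn 𝓘(ℝ, EM) 𝓘(ℝ, EG →L[ℝ] EG) ∞
      (fun x => (((𝒢.trivG x₀).coordChangeL ℝ (𝒢.trivG x₁) (𝒢.e x) :
        EG ≃L[ℝ] EG) : EG →L[ℝ] EG)) (𝒢.trivDomain x₀ ∩ 𝒢.trivDomain x₁) :=
    (contMDiffOn_coordChangeL (IB := 𝓘(ℝ, EG)) (n := ∞) (𝒢.trivG x₀) (𝒢.trivG x₁)).comp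
      𝒢.contMDiff_e.contMDiffOn fun x hx => ⟨hx.1.1.2, hx.2.1.2⟩
  have h2 : ContMDiffOn 𝓘(ℝ, EM) 𝓘(ℝ, EM × AlgebroidModel EM EG →L[ℝ] EG) ∞
      (fun x => (𝒢.splitT x₀ x).inverse) (𝒢.trivDomain x₀ ∩ 𝒢.trivDomain x₁) := by
    intro x hx
    obtain ⟨E, hE⟩ := hx.1.2
    have := contDiffAt_map_inverse (n := ∞) E
    rw [hE] at this
    exact this.contMDiffAt.comp_contMDiffWithinAt x
      (((𝒢.contMDiffOn_splitT x₀) x hx.1.1).mono fun y hy => hy.1.1)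
  exact (contMDiffOn_const (c := 𝒢.complProj x₁)).clm_comp
    (h1.clm_comp (h2.clm_comp contMDiffOn_const))

/-- The smooth vector bundle over `M` with fibres `ker dt` at `e x`, as a subbundle of the pullback
of `TG` along `e`. -/
def algebroidPrebundle :
    VectorPrebundle ℝ (AlgebroidModel EM EG) 𝒢.AlgebroidFiber where
  pretrivializationAtlas := range 𝒢.algebroidTriv
  pretrivialization_linear' := by rintro _ ⟨x₀, rfl⟩; infer_instance
  pretrivializationAt := 𝒢.algebroidTriv
  mem_base_pretrivializationAt := 𝒢.mem_trivDomain
  pretrivialization_mem_atlas x₀ := mem_range_self x₀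
  exists_coordChange := by
    rintro _ ⟨x₀, rfl⟩ _ ⟨x₁, rfl⟩
    exact ⟨𝒢.algebroidCoordChange x₀ x₁, (𝒢.contMDiffOn_algebroidCoordChange x₀ x₁).continuousOn,
      fun x hx w => 𝒢.algebroidCoordChange_apply hx w⟩
  totalSpaceMk_isInducing x := by
    refine Topology.IsInducing.of_comp (g := fun p : M × AlgebroidModel EM EG => 𝒢.fiberVec x x p.2)
      (continuous_const.prodMk (𝒢.fiberCoord x x).continuous)
      ((𝒢.fiberVec x x).continuous.comp continuous_snd) ?_
    have h : (fun p : M × AlgebroidModel EM EG => 𝒢.fiberVec x x p.2) ∘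
        (𝒢.algebroidTriv x ∘ TotalSpace.mk x) = Subtype.val :=
      funext fun v => 𝒢.fiberVec_fiberCoord (𝒢.mem_trivDomain x) v
    rw [h]
    exact Topology.IsInducing.subtypeVal

instance : TopologicalSpace (TotalSpace (AlgebroidModel EM EG) 𝒢.AlgebroidFiber) :=
  𝒢.algebroidPrebundle.totalSpaceTopology

instance : FiberBundle (AlgebroidModel EM EG) 𝒢.AlgebroidFiber :=
  𝒢.algebroidPrebundle.toFiberBundle

instance : VectorBundle ℝ (AlgebroidModel EM EG) 𝒢.AlgebroidFiber :=
  𝒢.algebroidPrebundle.toVectorBundle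

instance : 𝒢.algebroidPrebundle.IsContMDiff 𝓘(ℝ, EM) ∞ where
  exists_contMDiffCoordChange := by
    rintro _ ⟨x₀, rfl⟩ _ ⟨x₁, rfl⟩
    exact ⟨𝒢.algebroidCoordChange x₀ x₁, 𝒢.contMDiffOn_algebroidCoordChange x₀ x₁,
      fun x hx w => 𝒢.algebroidCoordChange_apply hx w⟩

instance : ContMDiffVectorBundle ∞ (AlgebroidModel EM EG) 𝒢.AlgebroidFiber 𝓘(ℝ, EM) :=
  𝒢.algebroidPrebundle.contMDiffVectorBundle 𝓘(ℝ, EM)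

/-- A section of the algebroid is smooth iff it is smooth as a map into the tangent bundle. -/
theorem contMDiff_section_iff (σ : ∀ x, 𝒢.AlgebroidFiber x) :
    ContMDiff 𝓘(ℝ, EM) (𝓘(ℝ, EM).prod 𝓘(ℝ, AlgebroidModel EM EG)) ∞
        (fun x => TotalSpace.mk' (AlgebroidModel EM EG) x (σ x)) ↔
      ContMDiff 𝓘(ℝ, EM) (𝓘(ℝ, EG).prod 𝓘(ℝ, EG)) ∞
        (fun x => (TotalSpace.mk' EG (𝒢.e x) (σ x : TangentSpace 𝓘(ℝ, EG) (𝒢.e x)) :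
          TangentBundle 𝓘(ℝ, EG) G)) := by
  refine forall_congr' fun x₀ => ?_
  rw [contMDiffAt_section, Bundle.contMDiffAt_totalSpace]
  have hU : 𝒢.trivDomain x₀ ∈ 𝓝 x₀ := (𝒢.isOpen_trivDomain x₀).mem_nhds (𝒢.mem_trivDomain x₀)
  have hc : ∀ x ∈ 𝒢.trivDomain x₀, (𝒢.trivG x₀ ⟨𝒢.e x, σ x⟩).2 =
      (𝒢.trivG x₀).continuousLinearMapAt ℝ (𝒢.e x) (σ x) := fun x hx =>
    (Trivialization.continuousLinearMapAt_apply_of_mem (R := ℝ) _ hx.1.2 _).symm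
  constructor
  · intro h
    refine ⟨𝒢.contMDiff_e x₀, ?_⟩
    have h2 : ContMDiffAt 𝓘(ℝ, EM) 𝓘(ℝ, EM × AlgebroidModel EM EG →L[ℝ] EG) ∞
        (fun x => (𝒢.splitT x₀ x).inverse) x₀ := by
      obtain ⟨E, hE⟩ := (𝒢.mem_trivDomain x₀).2
      have := contDiffAt_map_inverse (n := ∞) E
      rw [hE] at this
      exact this.contMDiffAt.comp x₀ ((𝒢.contMDiffOn_splitT x₀).contMDiffAt
        ((𝒢.isOpen_domT x₀).mem_nhds (𝒢.mem_domT x₀)))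
    have h3 := (h2.clm_comp (contMDiffAt_const
      (c := ContinuousLinearMap.inr ℝ EM (AlgebroidModel EM EG)))).clm_apply h
    refine h3.congr_of_eventuallyEq ?_
    filter_upwards [hU] with x hx
    have h4 := congrArg ((𝒢.trivG x₀).continuousLinearMapAt ℝ (𝒢.e x))
      (𝒢.fiberVec_fiberCoord hx (σ x))
    refine (hc x hx).trans (h4.symm.trans ?_)
    exact Trivialization.continuousLinearMapAt_symmL _ hx.1.2 _
  · rintro ⟨-, h⟩
    refine ((𝒢.complProj x₀).contMDiff.contMDiffAt.comp x₀ h).congr_of_eventuallyEq ?_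
    filter_upwards [hU] with x hx
    exact congrArg (𝒢.complProj x₀) (hc x hx).symm

/-- The left invariant `t`-vertical vector field on `G` defined by a section `σ` of the Lie algebroid:
its value at `γ` is `d L_γ (σ (s γ))`, where the left translation `L_γ h = γ h` is a map from the
`t`-fibre over `s γ` to the `t`-fibre over `t γ`. The derivative is taken within the `t`-fibre, and
only its (uniquely determined) value on a vector tangent to this fibre is used. The result lies in
the tangent space at `γ (e (s γ)) = γ`. -/
def leftInvariant (σ : ∀ x, 𝒢.AlgebroidFiber x) (γ : G) : TangentSpace 𝓘(ℝ, EG) γ :=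
  mfderivWithin 𝓘(ℝ, EG) 𝓘(ℝ, EG) (𝒢.mul γ) {h | 𝒢.t h = 𝒢.s γ} (𝒢.e (𝒢.s γ))
    (σ (𝒢.s γ) : TangentSpace 𝓘(ℝ, EG) (𝒢.e (𝒢.s γ)))

end LieGroupoid

section

variable (EM : Type*) {M : Type*} [NormedAddCommGroup EM] [NormedSpace ℝ EM]
  [TopologicalSpace M] [ChartedSpace EM M] [IsManifold 𝓘(ℝ, EM) ∞ M]
  (F : Type*) [NormedAddCommGroup F] [NormedSpace ℝ F]
  (A : M → Type*) [TopologicalSpace (TotalSpace F A)] [∀ x, AddCommGroup (A x)]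
  [∀ x, Module ℝ (A x)] [∀ x, TopologicalSpace (A x)] [FiberBundle F A] [VectorBundle ℝ F A]
  [ContMDiffVectorBundle ∞ F A 𝓘(ℝ, EM)]

/-- A Lie algebroid structure on a smooth vector bundle `A` over `M`: a smooth bundle map
`A → TM`, the anchor, and a Lie bracket on the space of smooth sections of `A` that satisfies
`[σ, f τ] = f [σ, τ] + (ρ(σ) f) τ`. -/
structure LieAlgebroid where
  /-- The anchor. -/
  anchor : ∀ x, A x →L[ℝ] TangentSpace 𝓘(ℝ, EM) x
  contMDiff_anchor : ContMDiff (𝓘(ℝ, EM).prod 𝓘(ℝ, F)) (𝓘(ℝ, EM).prod 𝓘(ℝ, EM)) ∞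
    (fun v : TotalSpace F A => (⟨v.proj, anchor v.proj v.2⟩ : TangentBundle 𝓘(ℝ, EM) M))
  /-- The bracket of smooth sections. -/
  bracket : Cₛ^∞⟮𝓘(ℝ, EM); F, A⟯ →ₗ[ℝ] Cₛ^∞⟮𝓘(ℝ, EM); F, A⟯ →ₗ[ℝ] Cₛ^∞⟮𝓘(ℝ, EM); F, A⟯
  bracket_self : ∀ σ, bracket σ σ = 0
  jacobi : ∀ σ τ υ, bracket σ (bracket τ υ) = bracket (bracket σ τ) υ + bracket τ (bracket σ υ)
  leibniz : ∀ (σ τ τ' : Cₛ^∞⟮𝓘(ℝ, EM); F, A⟯) (f : M → ℝ), ContMDiff 𝓘(ℝ, EM) 𝓘(ℝ, ℝ) ∞ f →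
    (∀ x, τ' x = f x • τ x) → ∀ x, bracket σ τ' x =
      f x • bracket σ τ x + mvfderiv 𝓘(ℝ, EM) f x (anchor x (σ x)) • τ x

/-- A smooth Riemannian metric on a manifold. -/
abbrev SmoothMetric (E N : Type*) [NormedAddCommGroup E] [NormedSpace ℝ E] [TopologicalSpace N]
    [ChartedSpace E N] [IsManifold 𝓘(ℝ, E) ∞ N] : Type _ :=
  ContMDiffRiemannianMetric 𝓘(ℝ, E) ∞ E (TangentSpace 𝓘(ℝ, E) : N → Type _)

/-- `p : (N, h) → (B, g)` is a Riemannian submersion: a smooth submersion whose differential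
is isometric on the orthogonal complement of its kernel. -/
structure IsRiemannianSubmersion {E E' N B : Type*} [NormedAddCommGroup E] [NormedSpace ℝ E]
    [NormedAddCommGroup E'] [NormedSpace ℝ E'] [TopologicalSpace N] [ChartedSpace E N]
    [IsManifold 𝓘(ℝ, E) ∞ N] [TopologicalSpace B] [ChartedSpace E' B] [IsManifold 𝓘(ℝ, E') ∞ B]
    (h : SmoothMetric E N) (g : SmoothMetric E' B) (p : N → B) : Prop where
  contMDiff : ContMDiff 𝓘(ℝ, E) 𝓘(ℝ, E') ∞ p
  surjective_mfderiv : ∀ n, Function.Surjective (mfderiv 𝓘(ℝ, E) 𝓘(ℝ, E') p n)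
  isometric : ∀ (n : N) (v w : TangentSpace 𝓘(ℝ, E) n),
    (∀ u, mfderiv 𝓘(ℝ, E) 𝓘(ℝ, E') p n u = 0 → h.inner n v u = 0) →
    (∀ u, mfderiv 𝓘(ℝ, E) 𝓘(ℝ, E') p n u = 0 → h.inner n w u = 0) →
    g.inner (p n) (mfderiv 𝓘(ℝ, E) 𝓘(ℝ, E') p n v) (mfderiv 𝓘(ℝ, E) 𝓘(ℝ, E') p n w) =
      h.inner n v w

variable {EM F A} [∀ x, IsTopologicalAddGroup (A x)] [∀ x, ContinuousSMul ℝ (A x)]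

namespace LieAlgebroid

variable (𝒜 : LieAlgebroid EM F A) (cov : CovariantDerivative 𝓘(ℝ, EM) F A)

/-- The `A`-connection `ᵗ∇_σ X = [ρ(σ), X] + ρ(∇_X σ)` on `TM`. -/
def tauConnection (σ : ∀ x, A x) (X : ∀ x : M, TangentSpace 𝓘(ℝ, EM) x) (x : M) :
    TangentSpace 𝓘(ℝ, EM) x :=
  VectorField.mlieBracket 𝓘(ℝ, EM) (fun y => 𝒜.anchor y (σ y)) X x +
    𝒜.anchor x (cov σ x (X x))

/-- `(ᵗ∇_σ g)(X, Y) = ρ(σ)(g(X, Y)) - g(ᵗ∇_σ X, Y) - g(X, ᵗ∇_σ Y)`. -/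
def tauDerivMetric (g : SmoothMetric EM M) (σ : ∀ x, A x)
    (X Y : ∀ x : M, TangentSpace 𝓘(ℝ, EM) x) (x : M) : ℝ :=
  mvfderiv 𝓘(ℝ, EM) (fun y => g.inner y (X y) (Y y)) x (𝒜.anchor x (σ x)) -
    g.inner x (𝒜.tauConnection cov σ X x) (Y x) - g.inner x (X x) (𝒜.tauConnection cov σ Y x)

/-- `(A, ∇, g)` is a Killing Lie algebroid: `∇` is a smooth connection on the Lie algebroid `A` with
`ᵗ∇ g = 0`. -/
structure IsKilling (g : SmoothMetric EM M) : Prop where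
  contMDiff_connection : CovariantDerivative.ContMDiffCovariantDerivative cov ∞
  compatible : ∀ (σ : Cₛ^∞⟮𝓘(ℝ, EM); F, A⟯)
    (X Y : Cₛ^∞⟮𝓘(ℝ, EM); EM, (TangentSpace 𝓘(ℝ, EM) : M → Type _)⟯) (x : M),
    𝒜.tauDerivMetric cov g σ X Y x = 0

end LieAlgebroid

end

/-- `𝒜` is the Lie algebroid of `𝒢`: the anchor is the restriction of `ds`, and the bracket is the
Lie bracket of left invariant `t`-vertical vector fields on `G`. -/
structure LieGroupoid.IsLieAlgebroidOf {EM EG M G : Type*} [NormedAddCommGroup EM]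
    [NormedSpace ℝ EM] [NormedAddCommGroup EG] [NormedSpace ℝ EG] [TopologicalSpace M]
    [ChartedSpace EM M] [TopologicalSpace G] [ChartedSpace EG G] [IsManifold 𝓘(ℝ, EM) ∞ M]
    [IsManifold 𝓘(ℝ, EG) ∞ G] [FiniteDimensional ℝ EM] [FiniteDimensional ℝ EG]
    (𝒢 : LieGroupoid EM EG M G)
    (𝒜 : LieAlgebroid EM (LieGroupoid.AlgebroidModel EM EG) 𝒢.AlgebroidFiber) : Prop where
  anchor_eq : ∀ (x : M) (v : 𝒢.AlgebroidFiber x), 𝒜.anchor x v =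
    mfderiv 𝓘(ℝ, EG) 𝓘(ℝ, EM) 𝒢.s (𝒢.e x) (v : TangentSpace 𝓘(ℝ, EG) (𝒢.e x))
  leftInvariant_bracket : ∀ σ τ, 𝒢.leftInvariant (𝒜.bracket σ τ) =
    VectorField.mlieBracket 𝓘(ℝ, EG) (𝒢.leftInvariant σ) (𝒢.leftInvariant τ)

end

/-!
Write `V` for the left invariant vector field on `G` of a section `σ` of `A`. Every tangent vector
`u` of `M` at `x` gives two tangent vectors of `G` at the unit `e x`: the lift `uʰ` that is
horizontal for `s`, with `η(uʰ, v) = g(u, ds v)` for all `v`, and `ρ*u ∈ A_x`, the image of `u`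
under the adjoint of the anchor, with `η(ρ*u, w) = g(u, ρ w)` for all `w ∈ A_x`. Since `ρ = ds` on
`A_x = ker dt`, the difference `uʰ - ρ*u` is orthogonal to `ker dt`.

Let `N_V(z, w) = η(∇_z V, w)` for the Levi-Civita connection of `η`. Its symmetrization
`N_V(z, w) + N_V(w, z)` is the Lie derivative `L_V η`. The connection on `A` is defined by
`η(∇_u σ, w) = (L_V η)(w, uʰ) - N_V(w, ρ*u)` for `w ∈ A_x`. The left invariant field of `f σ` is
`(f ∘ s) V`, and the terms with a derivative of `f` in `N_{(f ∘ s) V}` combine to the Leibniz rule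
because `η(σ, uʰ) = g(ρσ, u) = η(σ, ρ*u)` and `ds uʰ = u` (`LieGroupoid.connection_smul`).

As `g(ρ ∇_u σ, v) = η(∇_u σ, ρ*v)`, symmetrizing in `u` and `v` gives
`(L_V η)(ρ*v, uʰ) + (L_V η)(ρ*u, vʰ) - (L_V η)(ρ*u, ρ*v)`,
which is `(L_V η)(uʰ, vʰ) - (L_V η)(uʰ - ρ*u, vʰ - ρ*v)`. The field `V` is tangent to the fibres of
the Riemannian submersion `t`, so `L_V η` vanishes on pairs of `t`-horizontal vectors, and the
last term is zero (`IsRiemannianSubmersion.koszulForm_horizontal_of_vertical`). The field `V` is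
`s`-related to `ρσ`, so the first term is `(L_{ρσ} g)(u, v)`
(`IsRiemannianSubmersion.koszulForm_horizontalLift`). This is the identity `ᵗ∇ g = 0`
(`LieGroupoid.tauDerivMetric_covariantDerivative`).

Both facts on Riemannian submersions follow, without flows, from the naturality of the Lie bracket
under maps with non-invertible derivative (`mfderiv_mlieBracket_of_related`). The Levi-Civita
connection is not constructed either; `N_V` is given by the Koszul formula, which is tensorial
(`SmoothMetric.koszulForm`).

The left translation by `γ` is defined on a `t`-fibre only. A local retraction onto the fibres of
a submersion (`exists_fiber_retraction`) extends the multiplication smoothly to non-composable pairs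
near `(γ, e (s γ))` (`LieGroupoid.exists_local_mul`). It follows that left invariant fields are
smooth, that they are preserved by the extended translations, and hence that their Lie bracket is
again left invariant (`LieGroupoid.leftInvariant_sectionBracket`).
-/

noncomputable section

/-! ### Fibres of submersions -/

section Submersion

variable {E E' N B : Type*} [NormedAddCommGroup E] [NormedSpace ℝ E] [FiniteDimensional ℝ E]
  [NormedAddCommGroup E'] [NormedSpace ℝ E']
  [TopologicalSpace N] [ChartedSpace E N] [IsManifold 𝓘(ℝ, E) ∞ N]
  [TopologicalSpace B] [ChartedSpace E' B]

/-- A submersion `p` has, near any point, a smooth map `ψ` sending `(y, n)` to a point of the fibre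
over `y` and fixing `n` if `y = p n`. For fixed `n` it is a local section of `p` through `n`; for
fixed `y` it is a local retraction onto the fibre over `y`. -/
theorem exists_fiber_retraction {p : N → B} (hp : ContMDiff 𝓘(ℝ, E) 𝓘(ℝ, E') ∞ p) (n₀ : N)
    (hs : Function.Surjective (mfderiv 𝓘(ℝ, E) 𝓘(ℝ, E') p n₀)) :
    ∃ ψ : B × N → N,
      ContMDiffAt (𝓘(ℝ, E').prod 𝓘(ℝ, E)) 𝓘(ℝ, E) ∞ ψ (p n₀, n₀) ∧
      (∀ᶠ q in 𝓝 (p n₀, n₀), p (ψ q) = q.1) ∧ ∀ᶠ n in 𝓝 n₀, ψ (p n, n) = n := by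
  set φ := extChartAt 𝓘(ℝ, E) n₀ with hφ
  set χ := extChartAt 𝓘(ℝ, E') (p n₀) with hχ
  set a : E := φ n₀
  let f : E → E' := χ ∘ p ∘ φ.symm
  have hf : ContDiffAt ℝ ∞ f a := by
    have := (contMDiffAt_iff.1 (hp n₀)).2
    simpa [f, a, hφ, hχ, contDiffWithinAt_univ] using this
  have hsurj : Function.Surjective (fderiv ℝ f a) := by
    have h : mfderiv 𝓘(ℝ, E) 𝓘(ℝ, E') p n₀ = fderiv ℝ f a := by
      rw [(hp.mdifferentiableAt (by simp)).mfderiv]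
      simp [writtenInExtChartAt, f, a, hφ, hχ, fderivWithin_univ]
      rfl
    rw [h] at hs
    exact hs
  set L : E →L[ℝ] E' := fderiv ℝ f a
  -- Read in charts, `p` together with a projection `Q` onto `ker dp` is a local diffeomorphism `Φ`.
  obtain ⟨Q, hQ⟩ := L.ker_closedComplemented_of_finiteDimensional_range
  have hinj : Function.Injective (L.prod Q) := by
    rw [injective_iff_map_eq_zero]
    intro v hv
    have h1 : L v = 0 := congrArg Prod.fst hv
    have h2 : Q v = 0 := congrArg Prod.snd hv
    have h3 := hQ ⟨v, h1⟩
    rw [h2] at h3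
    exact (congrArg Subtype.val h3).symm
  have hsj : Function.Surjective (L.prod Q) := by
    rintro ⟨y, k⟩
    obtain ⟨v, rfl⟩ := hsurj y
    refine ⟨v - Q v + k, Prod.ext ?_ ?_⟩
    · have h1 : L (Q v) = 0 := (Q v).2
      have h2 : L k = 0 := k.2
      simp [h1, h2]
    · simp [hQ]
  let e : E ≃L[ℝ] E' × LinearMap.ker L.toLinearMap :=
    (LinearEquiv.ofBijective (L.prod Q).toLinearMap ⟨hinj, hsj⟩).toContinuousLinearEquiv
  let Φ : E → E' × LinearMap.ker L.toLinearMap := fun z => (f z, Q z)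
  have hΦ : ContDiffAt ℝ ∞ Φ a := hf.prodMk Q.contDiff.contDiffAt
  have hΦ' : HasFDerivAt Φ (e : E →L[ℝ] E' × LinearMap.ker L.toLinearMap) a :=
    ((hf.differentiableAt (by simp)).hasFDerivAt.prodMk Q.hasFDerivAt)
  have hst := hΦ.hasStrictFDerivAt' hΦ' (by simp)
  let inv := hΦ.localInverse hΦ' (by simp)
  have hinv : ContDiffAt ℝ ∞ inv (Φ a) := hΦ.to_localInverse hΦ' (by simp)
  have hinva : inv (Φ a) = a := hΦ.localInverse_apply_image hΦ' (by simp)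
  have hl : ∀ᶠ z in 𝓝 a, inv (Φ z) = z := hst.eventually_left_inverse
  have hr : ∀ᶠ w in 𝓝 (Φ a), Φ (inv w) = w := hst.eventually_right_inverse
  have hφa : φ.symm a = n₀ := extChartAt_to_inv n₀
  -- `ψ (y, n)` is the point at which `Φ` has the coordinate `y` of the base and the second
  -- component of `Φ n`.
  let c : B × N → E' × LinearMap.ker L.toLinearMap := fun q => (χ q.1, Q (φ q.2))
  have hc : ContMDiffAt (𝓘(ℝ, E').prod 𝓘(ℝ, E)) 𝓘(ℝ, E' × LinearMap.ker L.toLinearMap) ∞ c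
      (p n₀, n₀) := by
    refine ContMDiffAt.prodMk_space ?_ ?_
    · exact ContMDiffAt.comp (p n₀, n₀) (g := χ) contMDiffAt_extChartAt contMDiffAt_fst
    · exact Q.contMDiff.contMDiffAt.comp (p n₀, n₀)
        (ContMDiffAt.comp (p n₀, n₀) (g := φ) contMDiffAt_extChartAt contMDiffAt_snd)
  have hca : c (p n₀, n₀) = Φ a := by
    simp only [c, Φ, f, Function.comp_apply, hφa]
    rfl
  have hsy : ContMDiffAt 𝓘(ℝ, E) 𝓘(ℝ, E) ∞ φ.symm a :=
    (contMDiffOn_extChartAt_symm n₀).contMDiffAt (extChartAt_target_mem_nhds n₀)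
  have hψ : ContMDiffAt (𝓘(ℝ, E').prod 𝓘(ℝ, E)) 𝓘(ℝ, E) ∞ (φ.symm ∘ inv ∘ c) (p n₀, n₀) := by
    have h1 : ContMDiffAt 𝓘(ℝ, E' × LinearMap.ker L.toLinearMap) 𝓘(ℝ, E) ∞ inv
        (c (p n₀, n₀)) := by
      rw [hca]
      exact contMDiffAt_iff_contDiffAt.2 hinv
    have h2 : ContMDiffAt 𝓘(ℝ, E) 𝓘(ℝ, E) ∞ φ.symm (inv (c (p n₀, n₀))) := by
      rw [hca, hinva]
      exact hsy
    exact ContMDiffAt.comp (p n₀, n₀) h2 (h1.comp (p n₀, n₀) hc)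
  have hψ0 : (φ.symm ∘ inv ∘ c) (p n₀, n₀) = n₀ := by
    simp only [Function.comp_apply, hca, hinva, hφa]
  refine ⟨φ.symm ∘ inv ∘ c, hψ, ?_, ?_⟩
  · have h1 : ∀ᶠ q in 𝓝 (p n₀, n₀), Φ (inv (c q)) = c q := by
      have := hc.continuousAt
      rw [ContinuousAt, hca] at this
      exact this.eventually hr
    have h2 : ∀ᶠ q in 𝓝 (p n₀, n₀), q.1 ∈ χ.source :=
      continuousAt_fst.eventually (extChartAt_source_mem_nhds (I := 𝓘(ℝ, E')) (p n₀))
    have h3 : ∀ᶠ q in 𝓝 (p n₀, n₀), p ((φ.symm ∘ inv ∘ c) q) ∈ χ.source := by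
      have : ContinuousAt (fun q => p ((φ.symm ∘ inv ∘ c) q)) (p n₀, n₀) :=
        ContinuousAt.comp hp.continuous.continuousAt hψ.continuousAt
      refine this.eventually ?_
      change ∀ᶠ y in 𝓝 (p ((φ.symm ∘ inv ∘ c) (p n₀, n₀))), y ∈ χ.source
      rw [hψ0]
      exact extChartAt_source_mem_nhds (I := 𝓘(ℝ, E')) (p n₀)
    filter_upwards [h1, h2, h3] with q h1 h2 h3
    exact χ.injOn h3 h2 (congrArg Prod.fst h1)
  · have h1 : ∀ᶠ n in 𝓝 n₀, inv (Φ (φ n)) = φ n :=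
      (continuousAt_extChartAt (I := 𝓘(ℝ, E)) n₀).eventually hl
    filter_upwards [h1, extChartAt_source_mem_nhds (I := 𝓘(ℝ, E)) n₀] with n h1 h2
    have h3 : c (p n, n) = Φ (φ n) := by
      simp only [c, Φ, f, Function.comp_apply, φ.left_inv h2]
    simp only [Function.comp_apply, h3, h1, φ.left_inv h2]

/-- Two derivatives of a map within a fibre of a submersion agree on the tangent space of that
fibre. The fibre is not a set of unique differentiability, but by composition with a local retraction
onto the fibre a derivative within it becomes a derivative on an open set. -/
theorem HasMFDerivWithinAt.eq_on_ker_of_fiber {E'' N' : Type*} [NormedAddCommGroup E'']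
    [NormedSpace ℝ E''] [TopologicalSpace N'] [ChartedSpace E'' N']
    {p : N → B} (hp : ContMDiff 𝓘(ℝ, E) 𝓘(ℝ, E') ∞ p) {n₀ : N}
    (hs : Function.Surjective (mfderiv 𝓘(ℝ, E) 𝓘(ℝ, E') p n₀)) {f : N → N'}
    {f₁ f₂ : TangentSpace 𝓘(ℝ, E) n₀ →L[ℝ] TangentSpace 𝓘(ℝ, E'') (f n₀)} {b : B} (hb : p n₀ = b)
    (h₁ : HasMFDerivWithinAt 𝓘(ℝ, E) 𝓘(ℝ, E'') f {n | p n = b} n₀ f₁)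
    (h₂ : HasMFDerivWithinAt 𝓘(ℝ, E) 𝓘(ℝ, E'') f {n | p n = b} n₀ f₂)
    {v : TangentSpace 𝓘(ℝ, E) n₀} (hv : mfderiv 𝓘(ℝ, E) 𝓘(ℝ, E') p n₀ v = 0) : f₁ v = f₂ v := by
  subst hb
  obtain ⟨ψ, hψ, hψ1, hψ2⟩ := exists_fiber_retraction hp n₀ hs
  have hψ0 : ψ (p n₀, n₀) = n₀ := hψ2.self_of_nhds
  have hψd : MDifferentiableAt (𝓘(ℝ, E').prod 𝓘(ℝ, E)) 𝓘(ℝ, E) ψ (p n₀, n₀) :=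
    hψ.mdifferentiableAt (by simp)
  let r : N → N := fun n => ψ (p n₀, n)
  have hj : MDifferentiableAt 𝓘(ℝ, E) (𝓘(ℝ, E').prod 𝓘(ℝ, E)) (fun n : N => (p n₀, n)) n₀ :=
    mdifferentiableAt_const.prodMk mdifferentiableAt_id
  have hr : MDifferentiableAt 𝓘(ℝ, E) 𝓘(ℝ, E) r n₀ :=
    MDifferentiableAt.comp (g := ψ) (f := fun n : N => (p n₀, n)) n₀ hψd hj
  have hr0 : r n₀ = n₀ := hψ0
  have hrv : mfderiv 𝓘(ℝ, E) 𝓘(ℝ, E) r n₀ v = v := by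
    have hpd : MDifferentiableAt 𝓘(ℝ, E) 𝓘(ℝ, E') p n₀ := hp.mdifferentiableAt (by simp)
    have hk : MDifferentiableAt 𝓘(ℝ, E) (𝓘(ℝ, E').prod 𝓘(ℝ, E)) (fun n : N => (p n, n)) n₀ :=
      hpd.prodMk mdifferentiableAt_id
    have e1 : mfderiv 𝓘(ℝ, E) 𝓘(ℝ, E) (fun n => ψ (p n, n)) n₀ v = v := by
      have : (fun n => ψ (p n, n)) =ᶠ[𝓝 n₀] id := hψ2
      rw [this.mfderiv_eq, mfderiv_id]; rfl
    have e2 := mfderiv_comp_apply (g := ψ) (f := fun n : N => (p n, n)) n₀ hψd hk v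
    have e3 := mfderiv_comp_apply (g := ψ) (f := fun n : N => (p n₀, n)) n₀ hψd hj v
    have e4 : mfderiv 𝓘(ℝ, E) (𝓘(ℝ, E').prod 𝓘(ℝ, E)) (fun n : N => (p n, n)) n₀ v =
        mfderiv 𝓘(ℝ, E) (𝓘(ℝ, E').prod 𝓘(ℝ, E)) (fun n : N => (p n₀, n)) n₀ v := by
      have a1 := (hpd.hasMFDerivAt.prodMk (hasMFDerivAt_id n₀)).mfderiv
      have a2 := ((hasMFDerivAt_const (I := 𝓘(ℝ, E)) (I' := 𝓘(ℝ, E')) (p n₀) n₀).prodMk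
        (hasMFDerivAt_id n₀)).mfderiv
      refine (congrArg (fun A => A v) a1).trans (Eq.trans ?_ (congrArg (fun A => A v) a2).symm)
      exact Prod.ext hv rfl
    refine Eq.trans ?_ e1
    exact e3.trans ((congrArg _ e4.symm).trans e2.symm)
  have hmaps : ∀ᶠ n in 𝓝 n₀, p (r n) = p n₀ :=
    (Continuous.prodMk_right (p n₀)).continuousAt.eventually hψ1
  have key : ∀ A : TangentSpace 𝓘(ℝ, E) n₀ →L[ℝ] TangentSpace 𝓘(ℝ, E'') (f n₀),
      HasMFDerivWithinAt 𝓘(ℝ, E) 𝓘(ℝ, E'') f {n | p n = p n₀} n₀ A →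
      A v = mfderiv 𝓘(ℝ, E) 𝓘(ℝ, E'') (f ∘ r) n₀ v := by
    intro A hA
    have hA' : HasMFDerivWithinAt 𝓘(ℝ, E) 𝓘(ℝ, E'') f {n | p n = p n₀} (r n₀) A := by
      rw [hr0]; exact hA
    have h := HasMFDerivWithinAt.comp (s := {n | p (r n) = p n₀}) n₀ hA'
      (hr.hasMFDerivAt.hasMFDerivWithinAt) (fun n hn => hn)
    have h' := (h.hasMFDerivAt hmaps).mfderiv
    rw [h']
    change A v = A (mfderiv 𝓘(ℝ, E) 𝓘(ℝ, E) r n₀ v)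
    exact congrArg A hrv.symm
  rw [key f₁ h₁, key f₂ h₂]

end Submersion

/-! ### Naturality of the Lie bracket -/

section Related

open VectorField

variable {E E' N B : Type*} [NormedAddCommGroup E] [NormedSpace ℝ E] [FiniteDimensional ℝ E]
  [NormedAddCommGroup E'] [NormedSpace ℝ E'] [FiniteDimensional ℝ E']
  [TopologicalSpace N] [ChartedSpace E N] [IsManifold 𝓘(ℝ, E) ∞ N]
  [TopologicalSpace B] [ChartedSpace E' B] [IsManifold 𝓘(ℝ, E') ∞ B]

/-- A vector field on a manifold read in the preferred chart at `n₀`. -/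
def chartField (n₀ : N) (V : ∀ n : N, TangentSpace 𝓘(ℝ, E) n) (z : E) : E :=
  mpullbackWithin 𝓘(ℝ, E) 𝓘(ℝ, E) (extChartAt 𝓘(ℝ, E) n₀).symm V (range 𝓘(ℝ, E)) z

omit [FiniteDimensional ℝ E] in
theorem chartField_apply (n₀ : N) (V : ∀ n : N, TangentSpace 𝓘(ℝ, E) n) {z : E}
    (hz : z ∈ (extChartAt 𝓘(ℝ, E) n₀).target) :
    chartField n₀ V z =
      mfderiv 𝓘(ℝ, E) 𝓘(ℝ, E) (extChartAt 𝓘(ℝ, E) n₀) ((extChartAt 𝓘(ℝ, E) n₀).symm z)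
        (V ((extChartAt 𝓘(ℝ, E) n₀).symm z)) :=
  congrArg (fun A : E →L[ℝ] E => A (V ((extChartAt 𝓘(ℝ, E) n₀).symm z)))
    (ContinuousLinearMap.inverse_eq
      (mfderivWithin_extChartAt_symm_comp_mfderiv_extChartAt hz)
      (mfderiv_extChartAt_comp_mfderivWithin_extChartAt_symm hz))

theorem differentiableAt_chartField {n₀ : N} {V : ∀ n : N, TangentSpace 𝓘(ℝ, E) n}
    (hV : MDifferentiableAt 𝓘(ℝ, E) 𝓘(ℝ, E).tangent
      (fun n => (V n : TangentBundle 𝓘(ℝ, E) N)) n₀) :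
    DifferentiableAt ℝ (chartField n₀ V) (extChartAt 𝓘(ℝ, E) n₀ n₀) := by
  have h := (mdifferentiableWithinAt_univ.2
    hV).differentiableWithinAt_mpullbackWithin_vectorField
  have hs : (extChartAt 𝓘(ℝ, E) n₀).symm ⁻¹' univ ∩ range 𝓘(ℝ, E) = univ := by simp
  rw [hs] at h
  exact differentiableWithinAt_univ.1 h

omit [FiniteDimensional ℝ E] in
theorem mlieBracket_eq_lieBracket_chartField (V W : ∀ n : N, TangentSpace 𝓘(ℝ, E) n) (n₀ : N) :
    mlieBracket 𝓘(ℝ, E) V W n₀ =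
      lieBracket ℝ (chartField n₀ V) (chartField n₀ W) (extChartAt 𝓘(ℝ, E) n₀ n₀) := by
  have hs : (extChartAt 𝓘(ℝ, E) n₀).symm ⁻¹' univ ∩ range 𝓘(ℝ, E) = univ := by simp
  rw [← mlieBracketWithin_univ, mlieBracketWithin_apply, mfderiv_extChartAt_self, hs]
  change (ContinuousLinearMap.id ℝ E).inverse
    (lieBracketWithin ℝ (chartField n₀ V) (chartField n₀ W) univ _) = _
  rw [lieBracketWithin_univ, ContinuousLinearMap.inverse_id]
  rfl

/-- The Lie bracket is natural with respect to related vector fields: if `V`, `W` are `f`-related to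
`V'`, `W'` near `n₀`, then `[V, W]` is `f`-related to `[V', W']` at `n₀`. The derivative of `f` need
not be invertible. -/
theorem mfderiv_mlieBracket_of_related {f : N → B} {n₀ : N}
    (hf : ContMDiffAt 𝓘(ℝ, E) 𝓘(ℝ, E') ∞ f n₀)
    {V W : ∀ n : N, TangentSpace 𝓘(ℝ, E) n} {V' W' : ∀ b : B, TangentSpace 𝓘(ℝ, E') b}
    (hV : MDifferentiableAt 𝓘(ℝ, E) 𝓘(ℝ, E).tangent (fun n => (V n : TangentBundle 𝓘(ℝ, E) N)) n₀)
    (hW : MDifferentiableAt 𝓘(ℝ, E) 𝓘(ℝ, E).tangent (fun n => (W n : TangentBundle 𝓘(ℝ, E) N)) n₀)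
    (hV' : MDifferentiableAt 𝓘(ℝ, E') 𝓘(ℝ, E').tangent
      (fun b => (V' b : TangentBundle 𝓘(ℝ, E') B)) (f n₀))
    (hW' : MDifferentiableAt 𝓘(ℝ, E') 𝓘(ℝ, E').tangent
      (fun b => (W' b : TangentBundle 𝓘(ℝ, E') B)) (f n₀))
    (hVV : ∀ᶠ n in 𝓝 n₀, mfderiv 𝓘(ℝ, E) 𝓘(ℝ, E') f n (V n) = V' (f n))
    (hWW : ∀ᶠ n in 𝓝 n₀, mfderiv 𝓘(ℝ, E) 𝓘(ℝ, E') f n (W n) = W' (f n)) :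
    mfderiv 𝓘(ℝ, E) 𝓘(ℝ, E') f n₀ (mlieBracket 𝓘(ℝ, E) V W n₀) =
      mlieBracket 𝓘(ℝ, E') V' W' (f n₀) := by
  rw [mlieBracket_eq_lieBracket_chartField, mlieBracket_eq_lieBracket_chartField]
  have dV := differentiableAt_chartField hV
  have dW := differentiableAt_chartField hW
  have dV' := differentiableAt_chartField hV'
  have dW' := differentiableAt_chartField hW'
  set φ := extChartAt 𝓘(ℝ, E) n₀ with hφ
  set χ := extChartAt 𝓘(ℝ, E') (f n₀) with hχ
  let F : E → E' := χ ∘ f ∘ φ.symm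
  have hF : ContDiffAt ℝ ∞ F (φ n₀) := by
    have := (contMDiffAt_iff.1 hf).2
    simpa [F, hφ, hχ, contDiffWithinAt_univ] using this
  have hFd : mfderiv 𝓘(ℝ, E) 𝓘(ℝ, E') f n₀ = fderiv ℝ F (φ n₀) := by
    rw [(hf.mdifferentiableAt (by simp)).mfderiv]
    simp [writtenInExtChartAt, F, hφ, hχ, fderivWithin_univ]
    rfl
  have hF0 : F (φ n₀) = χ (f n₀) := by
    simp only [F, Function.comp_apply, hφ, extChartAt_to_inv]
  have hφsymm : ContinuousAt φ.symm (φ n₀) := continuousAt_extChartAt_symm n₀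
  have hn₀ : φ.symm (φ n₀) = n₀ := extChartAt_to_inv n₀
  have hfn : ∀ᶠ n in 𝓝 n₀, MDifferentiableAt 𝓘(ℝ, E) 𝓘(ℝ, E') f n := by
    filter_upwards [(contMDiffAt_iff_contMDiffAt_nhds (by simp)).1
      (ContMDiffAt.of_le hf (m := 1) (by simp))] with n hn
    exact hn.mdifferentiableAt one_ne_zero
  -- The fields read in the charts are `F`-related near `φ n₀`.
  have rel : ∀ (U : ∀ n : N, TangentSpace 𝓘(ℝ, E) n) (U' : ∀ b : B, TangentSpace 𝓘(ℝ, E') b),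
      (∀ᶠ n in 𝓝 n₀, mfderiv 𝓘(ℝ, E) 𝓘(ℝ, E') f n (U n) = U' (f n)) →
      (fun z => fderiv ℝ F z (chartField n₀ U z)) =ᶠ[𝓝 (φ n₀)]
        fun z => chartField (f n₀) U' (F z) := by
    intro U U' hU
    have a1 : ∀ᶠ z in 𝓝 (φ n₀), (mfderiv 𝓘(ℝ, E) 𝓘(ℝ, E') f (φ.symm z) (U (φ.symm z)) =
        U' (f (φ.symm z)) ∧ MDifferentiableAt 𝓘(ℝ, E) 𝓘(ℝ, E') f (φ.symm z)) ∧
        f (φ.symm z) ∈ χ.source := by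
      refine hφsymm.eventually (p := fun n => (mfderiv 𝓘(ℝ, E) 𝓘(ℝ, E') f n (U n) = U' (f n) ∧
        MDifferentiableAt 𝓘(ℝ, E) 𝓘(ℝ, E') f n) ∧ f n ∈ χ.source) ?_
      rw [hn₀]
      exact (hU.and hfn).and (hf.continuousAt.eventually
        (extChartAt_source_mem_nhds (I := 𝓘(ℝ, E')) (f n₀)))
    have a2 : ∀ᶠ z in 𝓝 (φ n₀), DifferentiableAt ℝ F z := by
      filter_upwards [(hF.of_le (m := 1) (by simp)).eventually (by simp)] with z hz
      exact hz.differentiableAt one_ne_zero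
    filter_upwards [a1, a2, extChartAt_target_mem_nhds (I := 𝓘(ℝ, E)) n₀] with z hz hFz hzt
    obtain ⟨⟨hU, hfd⟩, hs⟩ := hz
    have b1 := chartField_apply n₀ U hzt
    have hFz' : F z ∈ χ.target := χ.map_source hs
    have b2 := chartField_apply (f n₀) U' hFz'
    rw [b1, b2]
    set n := φ.symm z with hn
    have hns : n ∈ φ.source := φ.map_target hzt
    have hφn : φ n = z := φ.right_inv hzt
    have hχn : χ.symm (F z) = f n := χ.left_inv hs
    have c1 : MDifferentiableAt 𝓘(ℝ, E) 𝓘(ℝ, E) φ n :=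
      mdifferentiableAt_extChartAt (by simpa [hφ] using hns)
    have c2 : MDifferentiableAt 𝓘(ℝ, E') 𝓘(ℝ, E') χ (f n) :=
      mdifferentiableAt_extChartAt (I := 𝓘(ℝ, E')) (by simpa [hχ] using hs)
    have c3 : MDifferentiableAt 𝓘(ℝ, E) 𝓘(ℝ, E') F (φ n) := by
      rw [hφn]
      exact mdifferentiableAt_iff_differentiableAt.2 hFz
    have d1 := mfderiv_comp_apply (g := F) (f := φ) n c3 c1 (U n)
    have d2 := mfderiv_comp_apply (g := χ) (f := f) n c2 hfd (U n)
    have d3 : (F ∘ φ) =ᶠ[𝓝 n] χ ∘ f := by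
      filter_upwards [(isOpen_extChartAt_source (I := 𝓘(ℝ, E)) n₀).mem_nhds hns] with m hm
      simp only [F, Function.comp_apply, hφ, (extChartAt 𝓘(ℝ, E) n₀).left_inv hm]
    have d4 : mfderiv 𝓘(ℝ, E) 𝓘(ℝ, E') (F ∘ φ) n (U n) = mfderiv 𝓘(ℝ, E) 𝓘(ℝ, E') (χ ∘ f) n (U n) :=
      congrArg (fun A : E →L[ℝ] E' => A (U n)) (d3.mfderiv_eq (I := 𝓘(ℝ, E)) (I' := 𝓘(ℝ, E')))
    have e1 : fderiv ℝ F z = mfderiv 𝓘(ℝ, E) 𝓘(ℝ, E') F (φ n) := by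
      rw [hφn, mfderiv_eq_fderiv]
    have e2 : mfderiv 𝓘(ℝ, E') 𝓘(ℝ, E') χ (χ.symm (F z)) (U' (χ.symm (F z))) =
        mfderiv 𝓘(ℝ, E') 𝓘(ℝ, E') χ (f n) (U' (f n)) := by
      rw [hχn]
    refine Eq.trans ?_ e2.symm
    rw [e1]
    refine (d1.symm.trans (d4.trans d2)).trans ?_
    exact congrArg _ hU
  have rV := rel V V' hVV
  have rW := rel W W' hWW
  rw [hFd]
  refine (fderiv_apply_lieBracket (hF.of_le (m := 2) ENat.LEInfty.out)
    minSmoothness_of_isRCLikeNormedField.le dW dV).trans ?_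
  rw [rV.fderiv_eq, rW.fderiv_eq]
  have hFd' : DifferentiableAt ℝ F (φ n₀) := hF.differentiableAt (by simp)
  rw [← hF0] at dV' dW' ⊢
  have k1 := fderiv_comp (φ n₀) dV' hFd'
  have k2 := fderiv_comp (φ n₀) dW' hFd'
  have k3 : fderiv ℝ F (φ n₀) (chartField n₀ V (φ n₀)) = chartField (f n₀) V' (F (φ n₀)) :=
    rV.self_of_nhds
  have k4 : fderiv ℝ F (φ n₀) (chartField n₀ W (φ n₀)) = chartField (f n₀) W' (F (φ n₀)) :=
    rW.self_of_nhds
  simp only [Function.comp_def] at k1 k2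
  rw [k1, k2, lieBracket, ← k3, ← k4]
  rfl

end Related

/-! ### Smoothness of derivatives and of sections of vector bundles -/

section DerivativeOfFamilies

variable {E₁ E₂ E₃ N₁ N₂ N₃ : Type*}
  [NormedAddCommGroup E₁] [NormedSpace ℝ E₁] [NormedAddCommGroup E₂] [NormedSpace ℝ E₂]
  [NormedAddCommGroup E₃] [NormedSpace ℝ E₃]
  [TopologicalSpace N₁] [ChartedSpace E₁ N₁]
  [TopologicalSpace N₂] [ChartedSpace E₂ N₂] [IsManifold 𝓘(ℝ, E₂) ∞ N₂]
  [TopologicalSpace N₃] [ChartedSpace E₃ N₃] [IsManifold 𝓘(ℝ, E₃) ∞ N₃]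
  {f : N₁ → N₂ → N₃} {b : N₁ → N₂} {x₀ : N₁} {v : ∀ x, TangentSpace 𝓘(ℝ, E₂) (b x)}

/-- The derivatives of a smooth family of maps `f x`, applied to a smooth family of tangent vectors
`v x` over a smooth family of points `b x`, form a smooth family of tangent vectors. -/
theorem ContMDiffAt.mfderiv_apply_field [IsManifold 𝓘(ℝ, E₁) ∞ N₁]
    (hf : ContMDiffAt (𝓘(ℝ, E₁).prod 𝓘(ℝ, E₂)) 𝓘(ℝ, E₃) ∞ (Function.uncurry f) (x₀, b x₀))
    (hv : ContMDiffAt 𝓘(ℝ, E₁) 𝓘(ℝ, E₂).tangent ∞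
      (fun x => (⟨b x, v x⟩ : TangentBundle 𝓘(ℝ, E₂) N₂)) x₀) :
    ContMDiffAt 𝓘(ℝ, E₁) 𝓘(ℝ, E₃).tangent ∞
      (fun x => (⟨f x (b x), mfderiv 𝓘(ℝ, E₂) 𝓘(ℝ, E₃) (f x) (b x) (v x)⟩ :
        TangentBundle 𝓘(ℝ, E₃) N₃)) x₀ := by
  have hb : ContMDiffAt 𝓘(ℝ, E₁) 𝓘(ℝ, E₂) ∞ b x₀ := (contMDiffAt_totalSpace.1 hv).1
  refine ContMDiffAt.clm_apply_of_inCoordinates (F₁ := E₂) (F₂ := E₃)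
    (E₁ := (TangentSpace 𝓘(ℝ, E₂) : N₂ → Type _))
    (E₂ := (TangentSpace 𝓘(ℝ, E₃) : N₃ → Type _))
    (ϕ := fun x => mfderiv 𝓘(ℝ, E₂) 𝓘(ℝ, E₃) (f x) (b x)) (b₁ := b) (b₂ := fun x => f x (b x))
    (hf.mfderiv f b hb le_rfl) hv ?_
  exact hf.comp x₀ (contMDiffAt_id.prodMk hb)

theorem MDifferentiableAt.mfderiv_apply_field [IsManifold 𝓘(ℝ, E₁) ∞ N₁]
    (hf : ContMDiffAt (𝓘(ℝ, E₁).prod 𝓘(ℝ, E₂)) 𝓘(ℝ, E₃) ∞ (Function.uncurry f) (x₀, b x₀))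
    (hb : ContMDiffAt 𝓘(ℝ, E₁) 𝓘(ℝ, E₂) ∞ b x₀)
    (hv : MDifferentiableAt 𝓘(ℝ, E₁) 𝓘(ℝ, E₂).tangent
      (fun x => (⟨b x, v x⟩ : TangentBundle 𝓘(ℝ, E₂) N₂)) x₀) :
    MDifferentiableAt 𝓘(ℝ, E₁) 𝓘(ℝ, E₃).tangent
      (fun x => (⟨f x (b x), mfderiv 𝓘(ℝ, E₂) 𝓘(ℝ, E₃) (f x) (b x) (v x)⟩ :
        TangentBundle 𝓘(ℝ, E₃) N₃)) x₀ := by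
  refine MDifferentiableAt.clm_apply_of_inCoordinates (F₁ := E₂) (F₂ := E₃)
    (E₁ := (TangentSpace 𝓘(ℝ, E₂) : N₂ → Type _))
    (E₂ := (TangentSpace 𝓘(ℝ, E₃) : N₃ → Type _))
    (ϕ := fun x => mfderiv 𝓘(ℝ, E₂) 𝓘(ℝ, E₃) (f x) (b x)) (b₁ := b) (b₂ := fun x => f x (b x))
    ((hf.mfderiv f b hb le_rfl).mdifferentiableAt (by simp)) hv ?_
  exact (hf.comp x₀ (contMDiffAt_id.prodMk hb)).mdifferentiableAt (by simp)

theorem ContMDiffAt.mvfderiv_apply_field {f : N₂ → ℝ} {n₀ : N₂}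
    {V : ∀ n : N₂, TangentSpace 𝓘(ℝ, E₂) n} (hf : ContMDiffAt 𝓘(ℝ, E₂) 𝓘(ℝ, ℝ) ∞ f n₀)
    (hV : ContMDiffAt 𝓘(ℝ, E₂) 𝓘(ℝ, E₂).tangent ∞
      (fun n => (V n : TangentBundle 𝓘(ℝ, E₂) N₂)) n₀) :
    ContMDiffAt 𝓘(ℝ, E₂) 𝓘(ℝ, ℝ) ∞ (fun n => mvfderiv 𝓘(ℝ, E₂) f n (V n)) n₀ :=
  (contMDiff_snd_tangentBundle_modelSpace ℝ 𝓘(ℝ, ℝ)).contMDiffAt.comp n₀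
    (ContMDiffAt.mfderiv_apply_field (f := fun _ => f) (b := id)
      (hf.comp (n₀, n₀) contMDiffAt_snd) hV)

end DerivativeOfFamilies

section BundleSmoothness

variable {EB B : Type*} [NormedAddCommGroup EB] [NormedSpace ℝ EB]
  [TopologicalSpace B] [ChartedSpace EB B]
  {F₁ : Type*} [NormedAddCommGroup F₁] [NormedSpace ℝ F₁]
  {E₁ : B → Type*} [TopologicalSpace (TotalSpace F₁ E₁)] [∀ x, AddCommGroup (E₁ x)]
  [∀ x, Module ℝ (E₁ x)] [∀ x, TopologicalSpace (E₁ x)] [FiberBundle F₁ E₁] [VectorBundle ℝ F₁ E₁]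
  {F₂ : Type*} [NormedAddCommGroup F₂] [NormedSpace ℝ F₂]
  {E₂ : B → Type*} [TopologicalSpace (TotalSpace F₂ E₂)] [∀ x, AddCommGroup (E₂ x)]
  [∀ x, Module ℝ (E₂ x)] [∀ x, TopologicalSpace (E₂ x)] [FiberBundle F₂ E₂] [VectorBundle ℝ F₂ E₂]

theorem contMDiffAt_clm_of_apply {F G N : Type*} [NormedAddCommGroup F] [NormedSpace ℝ F]
    [FiniteDimensional ℝ F] [NormedAddCommGroup G] [NormedSpace ℝ G]
    [TopologicalSpace N] [ChartedSpace EB N]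
    {L : N → F →L[ℝ] G} {x₀ : N} (h : ∀ w, ContMDiffAt 𝓘(ℝ, EB) 𝓘(ℝ, G) ∞ (fun x => L x w) x₀) :
    ContMDiffAt 𝓘(ℝ, EB) 𝓘(ℝ, F →L[ℝ] G) ∞ L x₀ := by
  let b := Module.finBasis ℝ F
  have hsum : L = fun x => ∑ i, ContinuousLinearMap.smulRightL ℝ F G
      (LinearMap.toContinuousLinearMap (b.coord i)) (L x (b i)) := by
    funext x
    ext w
    conv_lhs => rw [← b.sum_repr w, map_sum]
    simp
  rw [hsum]
  refine contMDiffAt_finsetSum fun i _ => ?_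
  exact (ContinuousLinearMap.contMDiff _).contMDiffAt.comp x₀ (h (b i))

omit [NormedSpace ℝ F₁] [∀ x, Module ℝ (E₁ x)] [VectorBundle ℝ F₁ E₁] in
/-- The extensions `FiberBundle.extend` are constant in the trivialization. -/
theorem FiberBundle.extend_symm {x₀ : B} (w : F₁) (x : B) :
    FiberBundle.extend F₁ ((trivializationAt F₁ E₁ x₀).symm x₀ w) x =
      (trivializationAt F₁ E₁ x₀).symm x w := by
  have h := (trivializationAt F₁ E₁ x₀).apply_mk_symm (mem_baseSet_trivializationAt F₁ E₁ x₀) w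
  simp only [FiberBundle.extend, h]

/-- A section of a bundle of homomorphisms is smooth at `x₀` if it maps the local sections that
are constant in the trivialization around `x₀` to smooth sections. -/
theorem contMDiffAt_hom_section [FiniteDimensional ℝ F₁]
    [∀ x, IsTopologicalAddGroup (E₂ x)] [∀ x, ContinuousSMul ℝ (E₂ x)]
    {Φ : ∀ x, E₁ x →L[ℝ] E₂ x} {x₀ : B}
    (h : ∀ v : E₁ x₀, ContMDiffAt 𝓘(ℝ, EB) (𝓘(ℝ, EB).prod 𝓘(ℝ, F₂)) ∞
      (fun x => TotalSpace.mk' F₂ x (Φ x (FiberBundle.extend F₁ v x))) x₀) :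
    ContMDiffAt 𝓘(ℝ, EB) (𝓘(ℝ, EB).prod 𝓘(ℝ, F₁ →L[ℝ] F₂)) ∞
      (fun x => TotalSpace.mk' (F₁ →L[ℝ] F₂) (E := fun x => E₁ x →L[ℝ] E₂ x) x (Φ x)) x₀ := by
  refine (contMDiffAt_hom_bundle _).2 ⟨contMDiffAt_id, contMDiffAt_clm_of_apply fun w => ?_⟩
  have h1 := (contMDiffAt_section _).1 (h ((trivializationAt F₁ E₁ x₀).symm x₀ w))
  refine h1.congr_of_eventuallyEq ?_
  filter_upwards [(trivializationAt F₁ E₁ x₀).open_baseSet.mem_nhds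
    (mem_baseSet_trivializationAt F₁ E₁ x₀), (trivializationAt F₂ E₂ x₀).open_baseSet.mem_nhds
    (mem_baseSet_trivializationAt F₂ E₂ x₀)] with x hx1 hx2
  simp only [ContinuousLinearMap.inCoordinates, ContinuousLinearMap.comp_apply]
  rw [Trivialization.continuousLinearMapAt_apply_of_mem (R := ℝ) _ hx2,
    Trivialization.symmL_apply _ hx1, FiberBundle.extend_symm]

theorem contMDiffAt_trivial_section {N : Type*} [TopologicalSpace N] {EN : Type*}
    [NormedAddCommGroup EN] [NormedSpace ℝ EN] [ChartedSpace EN N]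
    {f : N → ℝ} {b : N → B} {x₀ : N} :
    ContMDiffAt 𝓘(ℝ, EN) (𝓘(ℝ, EB).prod 𝓘(ℝ, ℝ)) ∞
      (fun x => TotalSpace.mk' ℝ (E := Bundle.Trivial B ℝ) (b x) (f x)) x₀ ↔
    ContMDiffAt 𝓘(ℝ, EN) 𝓘(ℝ, EB) ∞ b x₀ ∧ ContMDiffAt 𝓘(ℝ, EN) 𝓘(ℝ, ℝ) ∞ f x₀ :=
  contMDiffAt_totalSpace

/-- A field of bilinear forms is smooth at `x₀` if its values on local sections that are constant
in the trivializations around `x₀` are smooth functions. -/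
theorem contMDiffAt_bilin_section [FiniteDimensional ℝ F₁] [FiniteDimensional ℝ F₂]
    {Φ : ∀ x, E₁ x →L[ℝ] E₂ x →L[ℝ] ℝ} {x₀ : B}
    (h : ∀ (v : E₁ x₀) (w : E₂ x₀), ContMDiffAt 𝓘(ℝ, EB) 𝓘(ℝ, ℝ) ∞
      (fun x => Φ x (FiberBundle.extend F₁ v x) (FiberBundle.extend F₂ w x)) x₀) :
    ContMDiffAt 𝓘(ℝ, EB) (𝓘(ℝ, EB).prod 𝓘(ℝ, F₁ →L[ℝ] F₂ →L[ℝ] ℝ)) ∞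
      (fun x => TotalSpace.mk' (F₁ →L[ℝ] F₂ →L[ℝ] ℝ)
        (E := fun x => E₁ x →L[ℝ] E₂ x →L[ℝ] ℝ) x (Φ x)) x₀ := by
  refine contMDiffAt_hom_section (E₂ := fun x => E₂ x →L[ℝ] Bundle.Trivial B ℝ x)
    fun v => contMDiffAt_hom_section (E₂ := Bundle.Trivial B ℝ) fun w => ?_
  exact contMDiffAt_trivial_section.2 ⟨contMDiffAt_id, h v w⟩

/-- Evaluation of a smooth field of bilinear forms along a map. -/
theorem ContMDiffAt.bilin_apply {N EN : Type*} [TopologicalSpace N]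
    [NormedAddCommGroup EN] [NormedSpace ℝ EN] [ChartedSpace EN N] {b : N → B}
    {Φ : ∀ x, E₁ x →L[ℝ] E₂ x →L[ℝ] ℝ} {x₀ : N} {v : ∀ x, E₁ (b x)} {w : ∀ x, E₂ (b x)}
    (hΦ : ContMDiffAt 𝓘(ℝ, EB) (𝓘(ℝ, EB).prod 𝓘(ℝ, F₁ →L[ℝ] F₂ →L[ℝ] ℝ)) ∞
      (fun x => TotalSpace.mk' (F₁ →L[ℝ] F₂ →L[ℝ] ℝ)
        (E := fun x => E₁ x →L[ℝ] E₂ x →L[ℝ] ℝ) x (Φ x)) (b x₀))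
    (hv : ContMDiffAt 𝓘(ℝ, EN) (𝓘(ℝ, EB).prod 𝓘(ℝ, F₁)) ∞
      (fun x => TotalSpace.mk' F₁ (b x) (v x)) x₀)
    (hw : ContMDiffAt 𝓘(ℝ, EN) (𝓘(ℝ, EB).prod 𝓘(ℝ, F₂)) ∞
      (fun x => TotalSpace.mk' F₂ (b x) (w x)) x₀) :
    ContMDiffAt 𝓘(ℝ, EN) 𝓘(ℝ, ℝ) ∞ (fun x => Φ (b x) (v x) (w x)) x₀ := by
  have hb : ContMDiffAt 𝓘(ℝ, EN) 𝓘(ℝ, EB) ∞ b x₀ := (contMDiffAt_totalSpace.1 hv).1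
  refine (contMDiffAt_trivial_section (EB := EB) (b := b)).1 ?_ |>.2
  exact ContMDiffAt.clm_bundle_apply₂ (F₁ := F₁) (F₂ := F₂) (F₃ := ℝ) (E₃ := Bundle.Trivial B ℝ)
    (hΦ.comp x₀ hb) hv hw

/-- A section `a` of a vector bundle with a smooth nondegenerate bilinear form is smooth at `x₀` if
its products with the local sections that are constant in the trivialization around `x₀` are smooth
functions. In the trivialization, the form is a smooth family of invertible maps to the dual space,
and so is its inverse. -/
theorem contMDiffAt_section_of_bilin [FiniteDimensional ℝ F₁]
    [ContMDiffVectorBundle ∞ F₁ E₁ 𝓘(ℝ, EB)]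
    {Φ : ∀ x, E₁ x →L[ℝ] E₁ x →L[ℝ] ℝ} {x₀ : B} {a : ∀ x, E₁ x}
    (hΦ : ContMDiffAt 𝓘(ℝ, EB) (𝓘(ℝ, EB).prod 𝓘(ℝ, F₁ →L[ℝ] F₁ →L[ℝ] ℝ)) ∞
      (fun x => TotalSpace.mk' (F₁ →L[ℝ] F₁ →L[ℝ] ℝ)
        (E := fun x => E₁ x →L[ℝ] E₁ x →L[ℝ] ℝ) x (Φ x)) x₀)
    (hinj : ∀ v : E₁ x₀, (∀ w, Φ x₀ v w = 0) → v = 0)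
    (ha : ∀ w : E₁ x₀, ContMDiffAt 𝓘(ℝ, EB) 𝓘(ℝ, ℝ) ∞
      (fun x => Φ x (a x) (FiberBundle.extend F₁ w x)) x₀) :
    ContMDiffAt 𝓘(ℝ, EB) (𝓘(ℝ, EB).prod 𝓘(ℝ, F₁)) ∞ (fun x => TotalSpace.mk' F₁ x (a x)) x₀ := by
  set e := trivializationAt F₁ E₁ x₀ with he
  have hx₀ : x₀ ∈ e.baseSet := mem_baseSet_trivializationAt F₁ E₁ x₀
  have hU : e.baseSet ∈ 𝓝 x₀ := e.open_baseSet.mem_nhds hx₀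
  have hext : ∀ w : F₁, ContMDiffAt 𝓘(ℝ, EB) (𝓘(ℝ, EB).prod 𝓘(ℝ, F₁)) ∞
      (fun x => TotalSpace.mk' F₁ x (e.symm x w)) x₀ := fun w =>
    (FiberBundle.contMDiffAt_extend (k := ∞) 𝓘(ℝ, EB) F₁ (e.symm x₀ w)).congr_of_eventuallyEq
      (Filter.Eventually.of_forall fun x => by simp only [he, FiberBundle.extend_symm])
  -- The form in the trivialization.
  let C : B → F₁ →L[ℝ] F₁ →L[ℝ] ℝ := fun x => LinearMap.toContinuousBilinearMap
    (LinearMap.mk₂ ℝ (fun v w => Φ x (e.symmL ℝ x v) (e.symmL ℝ x w))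
      (by simp) (by simp) (by simp) (by simp))
  have hC : ∀ x v w, C x v w = Φ x (e.symmL ℝ x v) (e.symmL ℝ x w) := fun _ _ _ => rfl
  have hCs : ContMDiffAt 𝓘(ℝ, EB) 𝓘(ℝ, F₁ →L[ℝ] F₁ →L[ℝ] ℝ) ∞ C x₀ := by
    refine contMDiffAt_clm_of_apply fun v => contMDiffAt_clm_of_apply fun w => ?_
    refine (ContMDiffAt.bilin_apply (b := id) hΦ (hext v) (hext w)).congr_of_eventuallyEq ?_
    filter_upwards [hU] with x hx
    rw [hC, e.symmL_apply hx, e.symmL_apply hx]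
    rfl
  have hCinj : Function.Injective (C x₀).toLinearMap := by
    rw [← LinearMap.ker_eq_bot, LinearMap.ker_eq_bot']
    intro v hv
    have h1 : e.symmL ℝ x₀ v = 0 := hinj _ fun w => by
      have h2 : C x₀ v (e.continuousLinearMapAt ℝ x₀ w) = 0 :=
        congrArg (fun A : F₁ →L[ℝ] ℝ => A (e.continuousLinearMapAt ℝ x₀ w)) hv
      rwa [hC, e.symmL_continuousLinearMapAt hx₀] at h2
    have h3 := congrArg (e.continuousLinearMapAt ℝ x₀) h1
    rwa [e.continuousLinearMapAt_symmL hx₀, map_zero] at h3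
  have hrank : Module.finrank ℝ F₁ = Module.finrank ℝ (F₁ →L[ℝ] ℝ) := by
    rw [← (LinearMap.toContinuousLinearMap (𝕜 := ℝ) (E := F₁) (F' := ℝ)).finrank_eq]
    exact Subspace.dual_finrank_eq.symm
  have hCx : C x₀ ∈ range ((↑) : (F₁ ≃L[ℝ] (F₁ →L[ℝ] ℝ)) → _) :=
    ⟨(LinearEquiv.ofInjectiveOfFinrankEq _ hCinj hrank).toContinuousLinearEquiv, by ext v; rfl⟩
  let ξ : B → F₁ →L[ℝ] ℝ := fun x => C x (e ⟨x, a x⟩).2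
  have hξ : ContMDiffAt 𝓘(ℝ, EB) 𝓘(ℝ, F₁ →L[ℝ] ℝ) ∞ ξ x₀ := by
    refine contMDiffAt_clm_of_apply fun w => ?_
    refine (ha (e.symm x₀ w)).congr_of_eventuallyEq ?_
    filter_upwards [hU] with x hx
    simp only [ξ, hC]
    rw [FiberBundle.extend_symm, ← e.continuousLinearMapAt_apply_of_mem (R := ℝ) hx,
      e.symmL_continuousLinearMapAt hx, e.symmL_apply hx]
  have hinv : ContMDiffAt 𝓘(ℝ, EB) 𝓘(ℝ, (F₁ →L[ℝ] ℝ) →L[ℝ] F₁) ∞ (fun x => (C x).inverse) x₀ := by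
    obtain ⟨A, hA⟩ := hCx
    have := contDiffAt_map_inverse (n := ∞) A
    rw [hA] at this
    exact this.contMDiffAt.comp x₀ hCs
  refine (contMDiffAt_section _).2 ((hinv.clm_apply hξ).congr_of_eventuallyEq ?_)
  filter_upwards [hCs.continuousAt.eventually (ContinuousLinearEquiv.isOpen.mem_nhds hCx)]
    with x hx
  obtain ⟨A, hA⟩ := hx
  simp only [ξ, ← hA]
  simp [he]

end BundleSmoothness

/-! ### The Koszul expression -/

section Koszul

open VectorField

variable {E N : Type*} [NormedAddCommGroup E] [NormedSpace ℝ E]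
  [TopologicalSpace N] [ChartedSpace E N] [IsManifold 𝓘(ℝ, E) ∞ N]

/-- Differentiability of a vector field at a point. -/
abbrev DiffFieldAt (V : ∀ n : N, TangentSpace 𝓘(ℝ, E) n) (n : N) : Prop :=
  MDifferentiableAt 𝓘(ℝ, E) 𝓘(ℝ, E).tangent (fun n => (V n : TangentBundle 𝓘(ℝ, E) N)) n

/-- Smoothness of a vector field at a point. -/
abbrev SmoothFieldAt (V : ∀ n : N, TangentSpace 𝓘(ℝ, E) n) (n : N) : Prop :=
  ContMDiffAt 𝓘(ℝ, E) 𝓘(ℝ, E).tangent ∞ (fun n => (V n : TangentBundle 𝓘(ℝ, E) N)) n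

variable {V Z W V' Z' W' : ∀ n : N, TangentSpace 𝓘(ℝ, E) n} {n : N}

theorem SmoothFieldAt.diffFieldAt (hV : SmoothFieldAt V n) : DiffFieldAt V n :=
  hV.mdifferentiableAt (by simp)

theorem SmoothFieldAt.eventually_diffFieldAt (hV : SmoothFieldAt V n) :
    ∀ᶠ m in 𝓝 n, DiffFieldAt V m := by
  filter_upwards [(contMDiffAt_iff_contMDiffAt_nhds (by simp)).1
    (ContMDiffAt.of_le hV (m := 1) (by simp))] with m hm
  exact hm.mdifferentiableAt one_ne_zero

theorem diffFieldAt_extend (v : TangentSpace 𝓘(ℝ, E) n) :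
    DiffFieldAt (FiberBundle.extend E v : ∀ n : N, TangentSpace 𝓘(ℝ, E) n) n :=
  FiberBundle.mdifferentiableAt_extend 𝓘(ℝ, E) E v

theorem smoothFieldAt_extend (v : TangentSpace 𝓘(ℝ, E) n) :
    SmoothFieldAt (FiberBundle.extend E v : ∀ n : N, TangentSpace 𝓘(ℝ, E) n) n :=
  FiberBundle.contMDiffAt_extend 𝓘(ℝ, E) E v

theorem SmoothFieldAt.mlieBracket [CompleteSpace E] (hV : SmoothFieldAt V n)
    (hW : SmoothFieldAt W n) : SmoothFieldAt (mlieBracket 𝓘(ℝ, E) V W) n := by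
  have : IsManifold 𝓘(ℝ, E) (((⊤ : ℕ∞) : WithTop ℕ∞) + 1) N :=
    inferInstanceAs (IsManifold 𝓘(ℝ, E) ∞ N)
  have : IsManifold 𝓘(ℝ, E) (minSmoothness ℝ 2) N := by
    rw [minSmoothness_of_isRCLikeNormedField]; infer_instance
  refine ContMDiffAt.mlieBracket_vectorField (m := ⊤) (n := ⊤) hV hW ?_
  rw [minSmoothness_of_isRCLikeNormedField]
  rfl

variable (h : SmoothMetric E N)

namespace SmoothMetric

theorem contMDiffAt_inner {E' N' : Type*} [NormedAddCommGroup E'] [NormedSpace ℝ E']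
    [TopologicalSpace N'] [ChartedSpace E' N'] {b : N' → N} {x₀ : N'}
    {v w : ∀ x, TangentSpace 𝓘(ℝ, E) (b x)}
    (hv : ContMDiffAt 𝓘(ℝ, E') 𝓘(ℝ, E).tangent ∞
      (fun x => (⟨b x, v x⟩ : TangentBundle 𝓘(ℝ, E) N)) x₀)
    (hw : ContMDiffAt 𝓘(ℝ, E') 𝓘(ℝ, E).tangent ∞
      (fun x => (⟨b x, w x⟩ : TangentBundle 𝓘(ℝ, E) N)) x₀) :
    ContMDiffAt 𝓘(ℝ, E') 𝓘(ℝ, ℝ) ∞ (fun x => h.inner (b x) (v x) (w x)) x₀ :=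
  ContMDiffAt.bilin_apply (h.contMDiff (b x₀)) hv hw

theorem mdifferentiableAt_inner (hV : DiffFieldAt V n) (hW : DiffFieldAt W n) :
    MDifferentiableAt 𝓘(ℝ, E) 𝓘(ℝ, ℝ) (fun m => h.inner m (V m) (W m)) n := by
  have hh := (h.contMDiff n).mdifferentiableAt (by simp)
  have key : MDifferentiableAt 𝓘(ℝ, E) (𝓘(ℝ, E).prod 𝓘(ℝ, ℝ))
      (fun m => TotalSpace.mk' ℝ (E := Bundle.Trivial N ℝ) m (h.inner m (V m) (W m))) n :=
    MDifferentiableAt.clm_bundle_apply₂ (F₁ := E) (F₂ := E) (F₃ := ℝ) (E₃ := Bundle.Trivial N ℝ)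
      hh hV hW
  exact ((mdifferentiableAt_totalSpace _ _).1 key).2

theorem eq_zero_of_inner (v : TangentSpace 𝓘(ℝ, E) n)
    (hv : h.inner n v v = 0) : v = 0 := by
  by_contra hne
  exact (h.pos n v hne).ne' hv

variable (V Z W n) in
/-- The right hand side of the Koszul formula: `h (∇_Z V) W` for the Levi-Civita connection `∇` of
the metric `h`. -/
def koszul : ℝ :=
  (1 / 2) * (mvfderiv 𝓘(ℝ, E) (fun m => h.inner m (Z m) (W m)) n (V n) +
    mvfderiv 𝓘(ℝ, E) (fun m => h.inner m (V m) (W m)) n (Z n) -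
    mvfderiv 𝓘(ℝ, E) (fun m => h.inner m (V m) (Z m)) n (W n) -
    h.inner n (mlieBracket 𝓘(ℝ, E) V Z n) (W n) - h.inner n (mlieBracket 𝓘(ℝ, E) V W n) (Z n) -
    h.inner n (mlieBracket 𝓘(ℝ, E) Z W n) (V n))

section

variable {f : N → ℝ}

theorem mvfderiv_inner_smul_left (hf : MDifferentiableAt 𝓘(ℝ, E) 𝓘(ℝ, ℝ) f n)
    (hV : DiffFieldAt V n) (hW : DiffFieldAt W n) (u : TangentSpace 𝓘(ℝ, E) n) :
    mvfderiv 𝓘(ℝ, E) (fun m => h.inner m ((f • V) m) (W m)) n u =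
      f n * mvfderiv 𝓘(ℝ, E) (fun m => h.inner m (V m) (W m)) n u +
        mvfderiv 𝓘(ℝ, E) f n u * h.inner n (V n) (W n) := by
  have e : (fun m => h.inner m ((f • V) m) (W m)) = f • fun m => h.inner m (V m) (W m) := by
    funext m; simp
  rw [e, mvfderiv_smul hf (h.mdifferentiableAt_inner hV hW)]
  simp

theorem mvfderiv_inner_add_left (hV : DiffFieldAt V n) (hV' : DiffFieldAt V' n)
    (hW : DiffFieldAt W n) (u : TangentSpace 𝓘(ℝ, E) n) :
    mvfderiv 𝓘(ℝ, E) (fun m => h.inner m ((V + V') m) (W m)) n u =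
      mvfderiv 𝓘(ℝ, E) (fun m => h.inner m (V m) (W m)) n u +
        mvfderiv 𝓘(ℝ, E) (fun m => h.inner m (V' m) (W m)) n u := by
  have e : (fun m => h.inner m ((V + V') m) (W m)) = (fun m => h.inner m (V m) (W m)) +
      fun m => h.inner m (V' m) (W m) := by
    funext m; simp
  rw [e, mvfderiv_add (h.mdifferentiableAt_inner hV hW) (h.mdifferentiableAt_inner hV' hW)]
  simp

variable (V W) in
theorem inner_swap : (fun m => h.inner m (V m) (W m)) = fun m => h.inner m (W m) (V m) :=
  funext fun m => h.symm m _ _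

/-- The symmetrization of the Koszul expression is the Lie derivative of the metric. -/
theorem koszul_add_swap :
    h.koszul V Z W n + h.koszul V W Z n =
      mvfderiv 𝓘(ℝ, E) (fun m => h.inner m (Z m) (W m)) n (V n) -
        h.inner n (mlieBracket 𝓘(ℝ, E) V Z n) (W n) -
        h.inner n (Z n) (mlieBracket 𝓘(ℝ, E) V W n) := by
  rw [h.symm n (Z n)]
  simp only [koszul, h.inner_swap Z W, mlieBracket_swap_apply (V := Z) (W := W), map_neg,
    neg_apply]
  ring

variable [CompleteSpace E]

theorem koszul_smul_field (hf : MDifferentiableAt 𝓘(ℝ, E) 𝓘(ℝ, ℝ) f n) (hV : DiffFieldAt V n)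
    (hZ : DiffFieldAt Z n) (hW : DiffFieldAt W n) :
    h.koszul (f • V) Z W n =
      f n * h.koszul V Z W n + mvfderiv 𝓘(ℝ, E) f n (Z n) * h.inner n (V n) (W n) := by
  have e1 : (f • V) n = f n • V n := rfl
  simp only [koszul, h.mvfderiv_inner_smul_left hf hV hW, h.mvfderiv_inner_smul_left hf hV hZ,
    mlieBracket_smul_left hf hV, e1, map_add, map_smul, add_apply,
    smul_apply, smul_eq_mul, map_neg, neg_apply, neg_smul]
  ring

theorem koszul_add_field (hV : DiffFieldAt V n) (hV' : DiffFieldAt V' n)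
    (hZ : DiffFieldAt Z n) (hW : DiffFieldAt W n) :
    h.koszul (V + V') Z W n = h.koszul V Z W n + h.koszul V' Z W n := by
  have e1 : (V + V') n = V n + V' n := rfl
  simp only [koszul, h.mvfderiv_inner_add_left hV hV' hW, h.mvfderiv_inner_add_left hV hV' hZ,
    mlieBracket_add_left hV hV', e1, map_add, add_apply]
  ring

theorem koszul_smul_left (hf : MDifferentiableAt 𝓘(ℝ, E) 𝓘(ℝ, ℝ) f n) (hV : DiffFieldAt V n)
    (hZ : DiffFieldAt Z n) (hW : DiffFieldAt W n) :
    h.koszul V (f • Z) W n = f n * h.koszul V Z W n := by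
  have e1 : (f • Z) n = f n • Z n := rfl
  simp only [koszul, h.mvfderiv_inner_smul_left hf hZ hW, h.inner_swap V (f • Z), h.inner_swap V Z,
    h.mvfderiv_inner_smul_left hf hZ hV, mlieBracket_smul_left hf hZ,
    mlieBracket_smul_right hf hZ, e1, map_add, map_smul, add_apply,
    smul_apply, smul_eq_mul, map_neg, neg_apply, neg_smul]
  ring

theorem koszul_smul_right (hf : MDifferentiableAt 𝓘(ℝ, E) 𝓘(ℝ, ℝ) f n) (hV : DiffFieldAt V n)
    (hZ : DiffFieldAt Z n) (hW : DiffFieldAt W n) :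
    h.koszul V Z (f • W) n = f n * h.koszul V Z W n := by
  have e1 : (f • W) n = f n • W n := rfl
  simp only [koszul, h.inner_swap Z (f • W), h.inner_swap Z W, h.inner_swap V (f • W),
    h.inner_swap V W, h.mvfderiv_inner_smul_left hf hW hZ,
    h.mvfderiv_inner_smul_left hf hW hV,
    mlieBracket_smul_right hf hW, e1, map_add, map_smul, add_apply,
    smul_apply, smul_eq_mul, h.symm n (W n)]
  ring

theorem koszul_add_left (hV : DiffFieldAt V n) (hZ : DiffFieldAt Z n) (hZ' : DiffFieldAt Z' n)
    (hW : DiffFieldAt W n) :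
    h.koszul V (Z + Z') W n = h.koszul V Z W n + h.koszul V Z' W n := by
  have e1 : (Z + Z') n = Z n + Z' n := rfl
  simp only [koszul, h.mvfderiv_inner_add_left hZ hZ' hW, h.inner_swap V (Z + Z'),
    h.inner_swap V Z, h.inner_swap V Z', h.mvfderiv_inner_add_left hZ hZ' hV,
    mlieBracket_add_left hZ hZ', mlieBracket_add_right hZ hZ', e1, map_add,
    add_apply]
  ring

theorem koszul_add_right (hV : DiffFieldAt V n) (hZ : DiffFieldAt Z n) (hW : DiffFieldAt W n)
    (hW' : DiffFieldAt W' n) :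
    h.koszul V Z (W + W') n = h.koszul V Z W n + h.koszul V Z W' n := by
  have e1 : (W + W') n = W n + W' n := rfl
  simp only [koszul, h.inner_swap Z (W + W'), h.inner_swap Z W, h.inner_swap Z W',
    h.inner_swap V (W + W'), h.inner_swap V W, h.inner_swap V W',
    h.mvfderiv_inner_add_left hW hW' hZ, h.mvfderiv_inner_add_left hW hW' hV,
    mlieBracket_add_right hW hW', e1, map_add, add_apply]
  ring

end

variable [FiniteDimensional ℝ E]

open Classical in
variable (V n) in
/-- The bilinear form `(Z, W) ↦ h (∇_Z V) W` on the tangent space at `n`, where `∇` is the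
Levi-Civita connection of `h`. The Koszul expression is tensorial in `Z` and `W` if `V` is
differentiable at `n`; otherwise the form is set to zero. -/
def koszulForm : TangentSpace 𝓘(ℝ, E) n →L[ℝ] TangentSpace 𝓘(ℝ, E) n →L[ℝ] ℝ :=
  haveI : CompleteSpace E := FiniteDimensional.complete ℝ E
  if hV : DiffFieldAt V n then
    TensorialAt.mkHom₂ (I := 𝓘(ℝ, E)) (F := E) (F' := E) (fun Z W => h.koszul V Z W n) n
      (fun _ hW => ⟨fun hf hZ => h.koszul_smul_left hf hV hZ hW,
        fun hZ hZ' => h.koszul_add_left hV hZ hZ' hW⟩)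
      (fun _ hZ => ⟨fun hf hW => h.koszul_smul_right hf hV hZ hW,
        fun hW hW' => h.koszul_add_right hV hZ hW hW'⟩)
  else 0

theorem koszulForm_apply (hV : DiffFieldAt V n) (hZ : DiffFieldAt Z n) (hW : DiffFieldAt W n) :
    h.koszulForm V n (Z n) (W n) = h.koszul V Z W n := by
  rw [koszulForm, dif_pos hV]
  exact TensorialAt.mkHom₂_apply _ _ hZ hW

theorem koszulForm_extend (hV : DiffFieldAt V n) (z w : TangentSpace 𝓘(ℝ, E) n) :
    h.koszulForm V n z w = h.koszul V (FiberBundle.extend E z) (FiberBundle.extend E w) n := by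
  rw [← h.koszulForm_apply hV (diffFieldAt_extend z) (diffFieldAt_extend w),
    FiberBundle.extend_apply_self, FiberBundle.extend_apply_self]

theorem koszulForm_add (hV : DiffFieldAt V n) (hV' : DiffFieldAt V' n)
    (z w : TangentSpace 𝓘(ℝ, E) n) :
    h.koszulForm (V + V') n z w = h.koszulForm V n z w + h.koszulForm V' n z w := by
  have : CompleteSpace E := FiniteDimensional.complete ℝ E
  rw [h.koszulForm_extend hV, h.koszulForm_extend hV',
    h.koszulForm_extend (mdifferentiableAt_add_section hV hV')]
  exact h.koszul_add_field hV hV' (diffFieldAt_extend z) (diffFieldAt_extend w)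

theorem koszulForm_smul {f : N → ℝ} (hf : MDifferentiableAt 𝓘(ℝ, E) 𝓘(ℝ, ℝ) f n)
    (hV : DiffFieldAt V n) (z w : TangentSpace 𝓘(ℝ, E) n) :
    h.koszulForm (f • V) n z w =
      f n * h.koszulForm V n z w + mvfderiv 𝓘(ℝ, E) f n z * h.inner n (V n) w := by
  have : CompleteSpace E := FiniteDimensional.complete ℝ E
  rw [h.koszulForm_extend hV, h.koszulForm_extend (hf.smul_section hV)]
  refine (h.koszul_smul_field hf hV (diffFieldAt_extend z) (diffFieldAt_extend w)).trans ?_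
  rw [FiberBundle.extend_apply_self, FiberBundle.extend_apply_self]

theorem koszulForm_add_swap (hV : DiffFieldAt V n) (hZ : DiffFieldAt Z n) (hW : DiffFieldAt W n) :
    h.koszulForm V n (Z n) (W n) + h.koszulForm V n (W n) (Z n) =
      mvfderiv 𝓘(ℝ, E) (fun m => h.inner m (Z m) (W m)) n (V n) -
        h.inner n (mlieBracket 𝓘(ℝ, E) V Z n) (W n) -
        h.inner n (Z n) (mlieBracket 𝓘(ℝ, E) V W n) := by
  have : CompleteSpace E := FiniteDimensional.complete ℝ E
  rw [h.koszulForm_apply hV hZ hW, h.koszulForm_apply hV hW hZ, h.koszul_add_swap]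

theorem contMDiffAt_koszul (hV : SmoothFieldAt V n) (hZ : SmoothFieldAt Z n)
    (hW : SmoothFieldAt W n) : ContMDiffAt 𝓘(ℝ, E) 𝓘(ℝ, ℝ) ∞ (h.koszul V Z W) n := by
  have : CompleteSpace E := FiniteDimensional.complete ℝ E
  have e1 := ContMDiffAt.mvfderiv_apply_field (h.contMDiffAt_inner hZ hW) hV
  have e2 := ContMDiffAt.mvfderiv_apply_field (h.contMDiffAt_inner hV hW) hZ
  have e3 := ContMDiffAt.mvfderiv_apply_field (h.contMDiffAt_inner hV hZ) hW
  have e4 := h.contMDiffAt_inner (hV.mlieBracket hZ) hW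
  have e5 := h.contMDiffAt_inner (hV.mlieBracket hW) hZ
  have e6 := h.contMDiffAt_inner (hZ.mlieBracket hW) hV
  exact contMDiffAt_const.mul (((((e1.add e2).sub e3).sub e4).sub e5).sub e6)

theorem contMDiffAt_koszulForm (hV : SmoothFieldAt V n) :
    ContMDiffAt 𝓘(ℝ, E) (𝓘(ℝ, E).prod 𝓘(ℝ, E →L[ℝ] E →L[ℝ] ℝ)) ∞
      (fun m => TotalSpace.mk' (E →L[ℝ] E →L[ℝ] ℝ)
        (E := fun m : N => TangentSpace 𝓘(ℝ, E) m →L[ℝ] TangentSpace 𝓘(ℝ, E) m →L[ℝ] ℝ)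
        m (h.koszulForm V m)) n := by
  refine contMDiffAt_bilin_section fun z w => ?_
  have hz := smoothFieldAt_extend z
  have hw := smoothFieldAt_extend w
  refine (h.contMDiffAt_koszul hV hz hw).congr_of_eventuallyEq ?_
  filter_upwards [hV.eventually_diffFieldAt, hz.eventually_diffFieldAt,
    hw.eventually_diffFieldAt] with m h1 h2 h3
  exact h.koszulForm_apply h1 h2 h3

end SmoothMetric

end Koszul

/-! ### Riemannian submersions -/

section Riesz

variable {V : Type*} [AddCommGroup V] [Module ℝ V] [FiniteDimensional ℝ V]

/-- The isomorphism of a finite-dimensional space with its dual given by a definite bilinear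
form. -/
def rieszEquiv (b : V →ₗ[ℝ] V →ₗ[ℝ] ℝ) (hb : ∀ v, b v v = 0 → v = 0) : V ≃ₗ[ℝ] Module.Dual ℝ V :=
  LinearEquiv.ofInjectiveOfFinrankEq b
    ((injective_iff_map_eq_zero b).2 fun v hv => hb v (by rw [hv, LinearMap.zero_apply]))
    Subspace.dual_finrank_eq.symm

theorem apply_rieszEquiv_symm (b : V →ₗ[ℝ] V →ₗ[ℝ] ℝ) (hb : ∀ v, b v v = 0 → v = 0)
    (φ : Module.Dual ℝ V) (v : V) : b ((rieszEquiv b hb).symm φ) v = φ v :=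
  LinearMap.congr_fun ((rieszEquiv b hb).apply_symm_apply φ) v

end Riesz

section RiemannianSubmersion

open VectorField

variable {E E' N B : Type*} [NormedAddCommGroup E] [NormedSpace ℝ E] [FiniteDimensional ℝ E]
  [NormedAddCommGroup E'] [NormedSpace ℝ E']
  [TopologicalSpace N] [ChartedSpace E N] [IsManifold 𝓘(ℝ, E) ∞ N]
  [TopologicalSpace B] [ChartedSpace E' B] [IsManifold 𝓘(ℝ, E') ∞ B]
  (h : SmoothMetric E N) (g : SmoothMetric E' B) (p : N → B)

instance (n : N) : FiniteDimensional ℝ (TangentSpace 𝓘(ℝ, E) n) :=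
  inferInstanceAs (FiniteDimensional ℝ E)

namespace SmoothMetric

variable {n : N}

/-- The restriction of a metric to a subspace of a tangent space, as a bilinear form. -/
def restrict (K : Submodule ℝ (TangentSpace 𝓘(ℝ, E) n)) : K →ₗ[ℝ] K →ₗ[ℝ] ℝ :=
  LinearMap.mk₂ ℝ (fun v w => h.inner n v w) (by simp) (by simp) (by simp) (by simp)

omit [FiniteDimensional ℝ E] in
theorem restrict_apply {K : Submodule ℝ (TangentSpace 𝓘(ℝ, E) n)} (v w : K) :
    h.restrict K v w = h.inner n v w := rfl

omit [FiniteDimensional ℝ E] in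
theorem restrict_definite (K : Submodule ℝ (TangentSpace 𝓘(ℝ, E) n)) (v : K)
    (hv : h.restrict K v v = 0) : v = 0 :=
  Subtype.ext (h.eq_zero_of_inner _ hv)

/-- The vector of the subspace `K` that represents the functional `φ` on `K` with respect to
the metric `h`. -/
def represent (K : Submodule ℝ (TangentSpace 𝓘(ℝ, E) n)) : Module.Dual ℝ K →ₗ[ℝ] K :=
  (rieszEquiv (h.restrict K) (h.restrict_definite K)).symm.toLinearMap

theorem inner_represent (K : Submodule ℝ (TangentSpace 𝓘(ℝ, E) n)) (φ : Module.Dual ℝ K) (v : K) :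
    h.inner n (h.represent K φ) v = φ v :=
  apply_rieszEquiv_symm (h.restrict K) (h.restrict_definite K) φ v

omit [FiniteDimensional ℝ E] in
theorem eq_of_inner_eq_on {K : Submodule ℝ (TangentSpace 𝓘(ℝ, E) n)} {v w : K}
    (hvw : ∀ u : K, h.inner n v u = h.inner n w u) : v = w := by
  rw [← sub_eq_zero]
  refine h.restrict_definite K _ ?_
  rw [h.restrict_apply]
  have := hvw (v - w)
  rw [← sub_eq_zero] at this
  simpa using this

/-- The horizontal lift of a tangent vector at `p n` with respect to a Riemannian submersion `p`. It
is characterized by `h (lift u) v = g u (dp v)` for all `v`. -/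
def horizontalLift (n : N) (u : TangentSpace 𝓘(ℝ, E') (p n)) : TangentSpace 𝓘(ℝ, E) n :=
  h.represent ⊤ (((g.inner (p n) u).toLinearMap.comp
    (mfderiv 𝓘(ℝ, E) 𝓘(ℝ, E') p n).toLinearMap).comp (Submodule.subtype _))

theorem inner_horizontalLift (n : N) (u : TangentSpace 𝓘(ℝ, E') (p n))
    (v : TangentSpace 𝓘(ℝ, E) n) : h.inner n (h.horizontalLift g p n u) v =
      g.inner (p n) u (mfderiv 𝓘(ℝ, E) 𝓘(ℝ, E') p n v) :=
  h.inner_represent ⊤ _ ⟨v, Submodule.mem_top⟩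

omit [FiniteDimensional ℝ E] in
theorem eq_of_inner_eq {v w : TangentSpace 𝓘(ℝ, E) n}
    (hvw : ∀ u, h.inner n v u = h.inner n w u) : v = w := by
  have := h.eq_of_inner_eq_on (K := ⊤) (v := ⟨v, Submodule.mem_top⟩) (w := ⟨w, Submodule.mem_top⟩)
    fun u => hvw u
  exact congrArg Subtype.val this

theorem horizontalLift_add (n : N) (u v : TangentSpace 𝓘(ℝ, E') (p n)) :
    h.horizontalLift g p n (u + v) = h.horizontalLift g p n u + h.horizontalLift g p n v :=
  h.eq_of_inner_eq fun w => by simp [inner_horizontalLift]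

theorem horizontalLift_smul (n : N) (c : ℝ) (u : TangentSpace 𝓘(ℝ, E') (p n)) :
    h.horizontalLift g p n (c • u) = c • h.horizontalLift g p n u :=
  h.eq_of_inner_eq fun w => by simp [inner_horizontalLift]

end SmoothMetric

variable {h g p}

namespace IsRiemannianSubmersion

variable (hp : IsRiemannianSubmersion h g p)

include hp in
/-- The horizontal lift, which is defined by its inner products, is a lift. -/
theorem mfderiv_horizontalLift [FiniteDimensional ℝ E'] (n : N)
    (u : TangentSpace 𝓘(ℝ, E') (p n)) :
    mfderiv 𝓘(ℝ, E) 𝓘(ℝ, E') p n (h.horizontalLift g p n u) = u := by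
  refine g.eq_of_inner_eq fun w => ?_
  -- A horizontal vector `v'` over `w`, obtained by subtracting the vertical component.
  obtain ⟨v, hv⟩ := hp.surjective_mfderiv n w
  let K : Submodule ℝ (TangentSpace 𝓘(ℝ, E) n) :=
    LinearMap.ker (mfderiv 𝓘(ℝ, E) 𝓘(ℝ, E') p n).toLinearMap
  let k := h.represent K ((h.inner n v).toLinearMap.comp K.subtype)
  have hk : mfderiv 𝓘(ℝ, E) 𝓘(ℝ, E') p n k = 0 := k.2
  have hv' : mfderiv 𝓘(ℝ, E) 𝓘(ℝ, E') p n (v - k) = w := by rw [map_sub, hk, sub_zero, hv]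
  have h1 := hp.isometric n (h.horizontalLift g p n u) (v - k)
    (fun u' hu' => by rw [h.inner_horizontalLift, hu', map_zero])
    (fun u' hu' => by
      have := h.inner_represent K ((h.inner n v).toLinearMap.comp K.subtype) ⟨u', hu'⟩
      have h2 : h.inner n k u' = h.inner n v u' := this
      rw [map_sub, sub_apply, h2, sub_self])
  rw [hv', h.inner_horizontalLift, hv'] at h1
  exact h1

include hp in
theorem horizontalLift_mfderiv [FiniteDimensional ℝ E'] (n : N) (v : TangentSpace 𝓘(ℝ, E) n)
    (hv : ∀ u, mfderiv 𝓘(ℝ, E) 𝓘(ℝ, E') p n u = 0 → h.inner n v u = 0) :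
    h.horizontalLift g p n (mfderiv 𝓘(ℝ, E) 𝓘(ℝ, E') p n v) = v := by
  refine h.eq_of_inner_eq fun w => ?_
  have h1 : h.inner n v (w - h.horizontalLift g p n (mfderiv 𝓘(ℝ, E) 𝓘(ℝ, E') p n w)) = 0 :=
    hv _ (by rw [map_sub, hp.mfderiv_horizontalLift, sub_self])
  rw [map_sub, sub_eq_zero, h.symm n v (h.horizontalLift _ _ _ _), h.inner_horizontalLift] at h1
  rw [h.inner_horizontalLift, h1, g.symm]

include hp in
theorem smoothFieldAt_horizontalLift {X : ∀ b : B, TangentSpace 𝓘(ℝ, E') b} {n : N}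
    (hX : SmoothFieldAt X (p n)) :
    SmoothFieldAt (fun m => h.horizontalLift g p m (X (p m))) n := by
  refine contMDiffAt_section_of_bilin (h.contMDiff n)
    (fun v hv => h.eq_zero_of_inner v (hv v)) fun w => ?_
  have hw : SmoothFieldAt _ n := smoothFieldAt_extend w
  have h1 := ContMDiffAt.mfderiv_apply_field (f := fun _ => p) (b := id)
    ((hp.contMDiff n).comp (n, n) contMDiffAt_snd) hw
  have h2 : ContMDiffAt 𝓘(ℝ, E) 𝓘(ℝ, E').tangent ∞
      (fun m => (⟨p m, X (p m)⟩ : TangentBundle 𝓘(ℝ, E') B)) n := hX.comp n (hp.contMDiff n)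
  refine (g.contMDiffAt_inner h2 h1).congr_of_eventuallyEq
    (Filter.Eventually.of_forall fun m => ?_)
  exact h.inner_horizontalLift g p m _ _

include hp in
/-- For a Riemannian submersion `p` and a vector field `V` that is `p`-related to `v`, the
Lie derivative of the metric along `V`, evaluated on horizontal lifts, is the Lie derivative of the
metric of the base along `v`. -/
theorem koszulForm_horizontalLift [FiniteDimensional ℝ E']
    {V : ∀ n : N, TangentSpace 𝓘(ℝ, E) n} {v X Y : ∀ b : B, TangentSpace 𝓘(ℝ, E') b} {n : N}
    (hV : DiffFieldAt V n) (hv : DiffFieldAt v (p n))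
    (hVv : ∀ᶠ m in 𝓝 n, mfderiv 𝓘(ℝ, E) 𝓘(ℝ, E') p m (V m) = v (p m))
    (hX : SmoothFieldAt X (p n)) (hY : SmoothFieldAt Y (p n)) :
    h.koszulForm V n (h.horizontalLift g p n (X (p n))) (h.horizontalLift g p n (Y (p n))) +
      h.koszulForm V n (h.horizontalLift g p n (Y (p n))) (h.horizontalLift g p n (X (p n))) =
      mvfderiv 𝓘(ℝ, E') (fun b => g.inner b (X b) (Y b)) (p n) (v (p n)) -
        g.inner (p n) (mlieBracket 𝓘(ℝ, E') v X (p n)) (Y (p n)) -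
        g.inner (p n) (X (p n)) (mlieBracket 𝓘(ℝ, E') v Y (p n)) := by
  have hXh := (hp.smoothFieldAt_horizontalLift hX).diffFieldAt
  have hYh := (hp.smoothFieldAt_horizontalLift hY).diffFieldAt
  have hrel : ∀ X : ∀ b : B, TangentSpace 𝓘(ℝ, E') b, ∀ᶠ m in 𝓝 n,
      mfderiv 𝓘(ℝ, E) 𝓘(ℝ, E') p m (h.horizontalLift g p m (X (p m))) = X (p m) := fun X =>
    Filter.Eventually.of_forall fun m => hp.mfderiv_horizontalLift m _
  have bX := mfderiv_mlieBracket_of_related (hp.contMDiff n) hV hXh hv hX.diffFieldAt hVv (hrel X)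
  have bY := mfderiv_mlieBracket_of_related (hp.contMDiff n) hV hYh hv hY.diffFieldAt hVv (hrel Y)
  refine (h.koszulForm_add_swap hV hXh hYh).trans ?_
  have e : (fun m => h.inner m (h.horizontalLift g p m (X (p m)))
      (h.horizontalLift g p m (Y (p m)))) = (fun b => g.inner b (X b) (Y b)) ∘ p := by
    funext m
    rw [h.inner_horizontalLift, hp.mfderiv_horizontalLift]
    rfl
  rw [e, mvfderiv_comp_apply n (g.mdifferentiableAt_inner hX.diffFieldAt hY.diffFieldAt)
    ((hp.contMDiff n).mdifferentiableAt (by simp)), hVv.self_of_nhds, h.inner_horizontalLift,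
    h.symm n _ (h.horizontalLift g p n (Y (p n))), h.inner_horizontalLift, bX, bY,
    g.symm _ (Y (p n))]

include hp in
/-- Along a vector field that is vertical for a Riemannian submersion, the Lie derivative of the
metric vanishes on horizontal vectors: they extend to horizontal lifts, and `V` is related to the
zero field of the base. -/
theorem koszulForm_horizontal_of_vertical [FiniteDimensional ℝ E']
    {V : ∀ n : N, TangentSpace 𝓘(ℝ, E) n} {n : N} (hV : DiffFieldAt V n)
    (hVv : ∀ᶠ m in 𝓝 n, mfderiv 𝓘(ℝ, E) 𝓘(ℝ, E') p m (V m) = 0) (z w : TangentSpace 𝓘(ℝ, E) n)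
    (hz : ∀ u, mfderiv 𝓘(ℝ, E) 𝓘(ℝ, E') p n u = 0 → h.inner n z u = 0)
    (hw : ∀ u, mfderiv 𝓘(ℝ, E) 𝓘(ℝ, E') p n u = 0 → h.inner n w u = 0) :
    h.koszulForm V n z w + h.koszulForm V n w z = 0 := by
  have h0 : DiffFieldAt (0 : ∀ b : B, TangentSpace 𝓘(ℝ, E') b) (p n) :=
    (contMDiff_zeroSection ℝ (TangentSpace 𝓘(ℝ, E') : B → Type _) (n := 1)
      (IB := 𝓘(ℝ, E')) (F := E')).contMDiffAt.mdifferentiableAt one_ne_zero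
  have key := hp.koszulForm_horizontalLift hV h0 hVv
    (smoothFieldAt_extend (mfderiv 𝓘(ℝ, E) 𝓘(ℝ, E') p n z))
    (smoothFieldAt_extend (mfderiv 𝓘(ℝ, E) 𝓘(ℝ, E') p n w))
  simp only [FiberBundle.extend_apply_self, hp.horizontalLift_mfderiv n z hz,
    hp.horizontalLift_mfderiv n w hw, mlieBracket_zero_left] at key
  simpa using key

end IsRiemannianSubmersion

end RiemannianSubmersion

/-! ### Left invariant vector fields -/

theorem tangentBundle_mk_eq {E N : Type*} [NormedAddCommGroup E] [NormedSpace ℝ E]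
    [TopologicalSpace N] [ChartedSpace E N] {a b : N} {v : TangentSpace 𝓘(ℝ, E) a}
    {w : TangentSpace 𝓘(ℝ, E) b} (hab : a = b) (hvw : (v : E) = (w : E)) :
    (⟨a, v⟩ : TangentBundle 𝓘(ℝ, E) N) = ⟨b, w⟩ := by
  subst hab
  exact congrArg (TotalSpace.mk a) hvw

namespace LieGroupoid

open VectorField

variable {EM EG M G : Type*} [NormedAddCommGroup EM] [NormedSpace ℝ EM]
  [NormedAddCommGroup EG] [NormedSpace ℝ EG]
  [TopologicalSpace M] [ChartedSpace EM M]
  [TopologicalSpace G] [ChartedSpace EG G] [IsManifold 𝓘(ℝ, EG) ∞ G] [FiniteDimensional ℝ EG]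
  (𝒢 : LieGroupoid EM EG M G)

/-- Near the pair of `γ₀` and its unit, the multiplication extends from composable pairs to a smooth
map `μ` on all pairs. The extended translation `μ γ₀` moves the arrows near the unit without
changing their source, and it commutes with right translations. -/
theorem exists_local_mul (γ₀ : G) : ∃ μ : G → G → G,
    ContMDiffAt (𝓘(ℝ, EG).prod 𝓘(ℝ, EG)) 𝓘(ℝ, EG) ∞ (Function.uncurry μ) (γ₀, 𝒢.e (𝒢.s γ₀)) ∧
    (∀ᶠ q in 𝓝 (γ₀, 𝒢.e (𝒢.s γ₀)), 𝒢.s q.1 = 𝒢.t q.2 → μ q.1 q.2 = 𝒢.mul q.1 q.2) ∧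
    ∀ᶠ h in 𝓝 (𝒢.e (𝒢.s γ₀)), 𝒢.s (μ γ₀ h) = 𝒢.s h ∧
      ∀ k, 𝒢.t k = 𝒢.s h → 𝒢.mul (μ γ₀ h) k = μ γ₀ (𝒢.mul h k) := by
  obtain ⟨ψ, hψ, hψs, hψid⟩ := exists_fiber_retraction 𝒢.contMDiff_s γ₀ (𝒢.surjective_mfderiv_s γ₀)
  set h₀ := 𝒢.e (𝒢.s γ₀) with hh₀
  have ht₀ : 𝒢.t h₀ = 𝒢.s γ₀ := 𝒢.t_e _
  let Ψ : G × G → G × G := fun q => (ψ (𝒢.t q.2, q.1), q.2)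
  have hΨ₁ : ContMDiffAt (𝓘(ℝ, EG).prod 𝓘(ℝ, EG)) (𝓘(ℝ, EM).prod 𝓘(ℝ, EG)) ∞
      (fun q : G × G => (𝒢.t q.2, q.1)) (γ₀, h₀) :=
    ((𝒢.contMDiff_t h₀).comp (γ₀, h₀) contMDiffAt_snd).prodMk contMDiffAt_fst
  have hpt : (fun q : G × G => (𝒢.t q.2, q.1)) (γ₀, h₀) = (𝒢.s γ₀, γ₀) := Prod.ext ht₀ rfl
  have hΨ : ContMDiffAt (𝓘(ℝ, EG).prod 𝓘(ℝ, EG)) (𝓘(ℝ, EG).prod 𝓘(ℝ, EG)) ∞ Ψ (γ₀, h₀) :=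
    (ContMDiffAt.comp_of_eq hψ hΨ₁ hpt).prodMk contMDiffAt_snd
  have hΨ₀ : Ψ (γ₀, h₀) = (γ₀, h₀) := by
    refine Prod.ext ?_ rfl
    change ψ (𝒢.t h₀, γ₀) = γ₀
    rw [ht₀]
    exact hψid.self_of_nhds
  have hs' : ∀ᶠ q in 𝓝 (γ₀, h₀), 𝒢.s (ψ (𝒢.t q.2, q.1)) = 𝒢.t q.2 := by
    have := hΨ₁.continuousAt.eventually (p := fun q => 𝒢.s (ψ q) = q.1) (by rw [hpt]; exact hψs)
    exact this
  -- The point `γ` is first moved to the `s`-fibre over `t h`, where it becomes composable with `h`.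
  refine ⟨fun γ h => 𝒢.mul (ψ (𝒢.t h, γ)) h, ?_, ?_, ?_⟩
  · have h1 := 𝒢.contMDiffOn_mul (Ψ (γ₀, h₀)) (by rw [hΨ₀]; exact ht₀.symm)
    refine (ContMDiffWithinAt.comp (γ₀, h₀) h1
      (hΨ.contMDiffWithinAt (s := {q : G × G | 𝒢.s (ψ (𝒢.t q.2, q.1)) = 𝒢.t q.2}))
      (fun q hq => hq)).contMDiffAt hs'
  · have := (continuous_fst.tendsto (γ₀, h₀)).eventually hψid
    filter_upwards [this] with q hq hst
    rw [← hst, hq]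
  · have hc : ContinuousAt (fun h : G => (γ₀, h)) h₀ := by fun_prop
    filter_upwards [hc.eventually hs'] with h hh
    refine ⟨𝒢.s_mul _ _ hh, fun k hk => ?_⟩
    rw [𝒢.t_mul h k hk.symm]
    exact 𝒢.mul_assoc _ _ _ hh hk.symm

variable {𝒢}

/-- A map `f` that agrees with the left translation by `γ` on the `t`-fibre computes the left
invariant fields at `γ`, in spite of the derivative within the fibre in their definition. -/
theorem leftInvariant_eq_mfderiv (σ : ∀ x, 𝒢.AlgebroidFiber x) {γ : G} {x : M}
    (hx : 𝒢.s γ = x) {f : G → G} (hf : MDifferentiableAt 𝓘(ℝ, EG) 𝓘(ℝ, EG) f (𝒢.e x))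
    (hfm : ∀ᶠ k in 𝓝 (𝒢.e x), 𝒢.t k = x → f k = 𝒢.mul γ k) :
    (𝒢.leftInvariant σ γ : EG) = (mfderiv 𝓘(ℝ, EG) 𝓘(ℝ, EG) f (𝒢.e x) (σ x) : EG) := by
  subst hx
  have h1 : HasMFDerivWithinAt 𝓘(ℝ, EG) 𝓘(ℝ, EG) f {k | 𝒢.t k = 𝒢.s γ} (𝒢.e (𝒢.s γ))
      (mfderiv 𝓘(ℝ, EG) 𝓘(ℝ, EG) f (𝒢.e (𝒢.s γ))) := hf.hasMFDerivAt.hasMFDerivWithinAt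
  have hev : 𝒢.mul γ =ᶠ[𝓝[{k | 𝒢.t k = 𝒢.s γ}] (𝒢.e (𝒢.s γ))] f := by
    filter_upwards [mem_nhdsWithin_of_mem_nhds hfm, self_mem_nhdsWithin] with k hk hk'
    exact (hk hk').symm
  have hev₀ : 𝒢.mul γ (𝒢.e (𝒢.s γ)) = f (𝒢.e (𝒢.s γ)) :=
    (hfm.self_of_nhds (𝒢.t_e _)).symm
  have h2 := (h1.congr_of_eventuallyEq hev hev₀).mdifferentiableWithinAt.hasMFDerivWithinAt
  have h3 := h1.congr_of_eventuallyEq hev hev₀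
  exact HasMFDerivWithinAt.eq_on_ker_of_fiber 𝒢.contMDiff_t (𝒢.surjective_mfderiv_t _)
    (𝒢.t_e _) h2 h3 (σ (𝒢.s γ)).2

/-- An extension of the left translation by `γ` from the `t`-fibre to a neighbourhood of the unit that
commutes with right translations. -/
theorem exists_leftTranslation (𝒢 : LieGroupoid EM EG M G) (γ : G) : ∃ f : G → G,
    ContMDiffAt 𝓘(ℝ, EG) 𝓘(ℝ, EG) ∞ f (𝒢.e (𝒢.s γ)) ∧ f (𝒢.e (𝒢.s γ)) = γ ∧
    (∀ᶠ k in 𝓝 (𝒢.e (𝒢.s γ)), 𝒢.t k = 𝒢.s γ → f k = 𝒢.mul γ k) ∧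
    ∀ᶠ h in 𝓝 (𝒢.e (𝒢.s γ)), 𝒢.s (f h) = 𝒢.s h ∧
      ∀ k, 𝒢.t k = 𝒢.s h → 𝒢.mul (f h) k = f (𝒢.mul h k) := by
  obtain ⟨μ, hμ, hμm, hμs⟩ := 𝒢.exists_local_mul γ
  have hc : ContinuousAt (fun h : G => (γ, h)) (𝒢.e (𝒢.s γ)) := by fun_prop
  refine ⟨μ γ, hμ.comp (𝒢.e (𝒢.s γ)) (contMDiffAt_const.prodMk contMDiffAt_id), ?_, ?_, hμs⟩
  · rw [hμm.self_of_nhds (𝒢.t_e _).symm, 𝒢.mul_e]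
  · filter_upwards [hc.eventually hμm] with k hk hk'
    exact hk hk'.symm

theorem leftInvariant_unit (σ : ∀ x, 𝒢.AlgebroidFiber x) (x : M) :
    𝒢.leftInvariant σ (𝒢.e x) = σ x := by
  refine (leftInvariant_eq_mfderiv σ (𝒢.s_e x) (f := id) mdifferentiableAt_id
    (Filter.Eventually.of_forall fun k hk => ?_)).trans ?_
  · rw [← hk, 𝒢.e_mul]; rfl
  · rw [mfderiv_id]; rfl

/-- If `q (γ k) = q' k` for all `k` in the `t`-fibre, then `dq` maps the left invariant field of
`σ` at `γ` to `dq' σ`. -/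
theorem mfderiv_leftInvariant {E' N' : Type*} [NormedAddCommGroup E'] [NormedSpace ℝ E']
    [TopologicalSpace N'] [ChartedSpace E' N'] (σ : ∀ x, 𝒢.AlgebroidFiber x) (γ : G)
    {q q' : G → N'} (hq : MDifferentiableAt 𝓘(ℝ, EG) 𝓘(ℝ, E') q γ)
    (hq' : MDifferentiableAt 𝓘(ℝ, EG) 𝓘(ℝ, E') q' (𝒢.e (𝒢.s γ)))
    (hqq : ∀ k, 𝒢.t k = 𝒢.s γ → q (𝒢.mul γ k) = q' k) :
    (mfderiv 𝓘(ℝ, EG) 𝓘(ℝ, E') q γ (𝒢.leftInvariant σ γ) : E') =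
      (mfderiv 𝓘(ℝ, EG) 𝓘(ℝ, E') q' (𝒢.e (𝒢.s γ)) (σ (𝒢.s γ)) : E') := by
  obtain ⟨f, hf, hfγ, hfm, -⟩ := 𝒢.exists_leftTranslation γ
  have hfd := hf.mdifferentiableAt (by simp)
  have hV := leftInvariant_eq_mfderiv σ rfl hfd hfm
  have h1 : HasMFDerivWithinAt 𝓘(ℝ, EG) 𝓘(ℝ, E') q' {k | 𝒢.t k = 𝒢.s γ} (𝒢.e (𝒢.s γ))
      (mfderiv 𝓘(ℝ, EG) 𝓘(ℝ, E') q' (𝒢.e (𝒢.s γ))) := hq'.hasMFDerivAt.hasMFDerivWithinAt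
  have hqf : MDifferentiableAt 𝓘(ℝ, EG) 𝓘(ℝ, E') q (f (𝒢.e (𝒢.s γ))) := by rw [hfγ]; exact hq
  have h2 : HasMFDerivWithinAt 𝓘(ℝ, EG) 𝓘(ℝ, E') (q ∘ f) {k | 𝒢.t k = 𝒢.s γ} (𝒢.e (𝒢.s γ))
      ((mfderiv 𝓘(ℝ, EG) 𝓘(ℝ, E') q (f (𝒢.e (𝒢.s γ)))).comp
        (mfderiv 𝓘(ℝ, EG) 𝓘(ℝ, EG) f (𝒢.e (𝒢.s γ)))) :=
    (hqf.hasMFDerivAt.comp _ hfd.hasMFDerivAt).hasMFDerivWithinAt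
  have hev : q' =ᶠ[𝓝[{k | 𝒢.t k = 𝒢.s γ}] (𝒢.e (𝒢.s γ))] q ∘ f := by
    filter_upwards [mem_nhdsWithin_of_mem_nhds hfm, self_mem_nhdsWithin] with k hk hk'
    rw [Function.comp_apply, hk hk']
    exact (hqq k hk').symm
  have hev₀ : q' (𝒢.e (𝒢.s γ)) = (q ∘ f) (𝒢.e (𝒢.s γ)) := by
    rw [Function.comp_apply, hfm.self_of_nhds (𝒢.t_e _)]
    exact (hqq _ (𝒢.t_e _)).symm
  have h3 := HasMFDerivWithinAt.eq_on_ker_of_fiber 𝒢.contMDiff_t (𝒢.surjective_mfderiv_t _)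
    (𝒢.t_e _) (h2.congr_of_eventuallyEq hev hev₀) h1 (σ (𝒢.s γ)).2
  refine Eq.trans ?_ h3
  have h4 : (mfderiv 𝓘(ℝ, EG) 𝓘(ℝ, E') q γ : EG →L[ℝ] E') =
      mfderiv 𝓘(ℝ, EG) 𝓘(ℝ, E') q (f (𝒢.e (𝒢.s γ))) := by rw [hfγ]
  exact (congrArg (fun A : EG →L[ℝ] E' => A (𝒢.leftInvariant σ γ)) h4).trans
    (congrArg (mfderiv 𝓘(ℝ, EG) 𝓘(ℝ, E') q (f (𝒢.e (𝒢.s γ))) : EG →L[ℝ] E') hV)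

theorem mfderiv_t_leftInvariant (σ : ∀ x, 𝒢.AlgebroidFiber x) (γ : G) :
    mfderiv 𝓘(ℝ, EG) 𝓘(ℝ, EM) 𝒢.t γ (𝒢.leftInvariant σ γ) = 0 := by
  refine (mfderiv_leftInvariant σ γ (q' := fun _ => 𝒢.t γ)
    ((𝒢.contMDiff_t γ).mdifferentiableAt (by simp)) mdifferentiableAt_const
    fun k hk => 𝒢.t_mul γ k hk.symm).trans ?_
  rw [mfderiv_const]; rfl

theorem mfderiv_s_leftInvariant (σ : ∀ x, 𝒢.AlgebroidFiber x) (γ : G) :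
    (mfderiv 𝓘(ℝ, EG) 𝓘(ℝ, EM) 𝒢.s γ (𝒢.leftInvariant σ γ) : EM) =
      (mfderiv 𝓘(ℝ, EG) 𝓘(ℝ, EM) 𝒢.s (𝒢.e (𝒢.s γ)) (σ (𝒢.s γ)) : EM) :=
  mfderiv_leftInvariant σ γ ((𝒢.contMDiff_s γ).mdifferentiableAt (by simp))
    ((𝒢.contMDiff_s _).mdifferentiableAt (by simp)) fun k hk => 𝒢.s_mul γ k hk.symm

theorem leftInvariant_eventuallyEq (σ : ∀ x, 𝒢.AlgebroidFiber x) {γ₀ : G} {μ : G → G → G}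
    (hμ : ContMDiffAt (𝓘(ℝ, EG).prod 𝓘(ℝ, EG)) 𝓘(ℝ, EG) ∞ (Function.uncurry μ)
      (γ₀, 𝒢.e (𝒢.s γ₀)))
    (hμm : ∀ᶠ q in 𝓝 (γ₀, 𝒢.e (𝒢.s γ₀)), 𝒢.s q.1 = 𝒢.t q.2 → μ q.1 q.2 = 𝒢.mul q.1 q.2) :
    (fun γ => (𝒢.leftInvariant σ γ : TangentBundle 𝓘(ℝ, EG) G)) =ᶠ[𝓝 γ₀] fun γ =>
      (⟨μ γ (𝒢.e (𝒢.s γ)), mfderiv 𝓘(ℝ, EG) 𝓘(ℝ, EG) (μ γ) (𝒢.e (𝒢.s γ)) (σ (𝒢.s γ))⟩ :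
        TangentBundle 𝓘(ℝ, EG) G) := by
  have hc : ContinuousAt (fun γ : G => (γ, 𝒢.e (𝒢.s γ))) γ₀ :=
    continuousAt_id.prodMk (𝒢.contMDiff_e.continuous.comp 𝒢.contMDiff_s.continuous).continuousAt
  have hμ1 := (contMDiffAt_iff_contMDiffAt_nhds (by simp)).1
    (ContMDiffAt.of_le hμ (m := 1) (by simp))
  filter_upwards [hc.eventually hμ1, hc.eventually hμm.eventually_nhds] with γ h1 h2
  have hd : MDifferentiableAt 𝓘(ℝ, EG) 𝓘(ℝ, EG) (μ γ) (𝒢.e (𝒢.s γ)) :=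
    (h1.comp (𝒢.e (𝒢.s γ)) (contMDiffAt_const.prodMk contMDiffAt_id)).mdifferentiableAt one_ne_zero
  have hc' : ContinuousAt (fun h : G => (γ, h)) (𝒢.e (𝒢.s γ)) := by fun_prop
  refine tangentBundle_mk_eq ?_ (leftInvariant_eq_mfderiv σ rfl hd ?_)
  · rw [h2.self_of_nhds (𝒢.t_e _).symm, 𝒢.mul_e]
  · filter_upwards [hc'.eventually h2] with k hk hk'
    exact hk hk'.symm

/-- The extended left translations preserve the left invariant fields, also at arrows outside the
`t`-fibre of the unit: they commute with right translations. -/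
theorem eventually_mfderiv_leftTranslation (σ : ∀ x, 𝒢.AlgebroidFiber x) {γ : G} {f : G → G}
    (hf : ContMDiffAt 𝓘(ℝ, EG) 𝓘(ℝ, EG) ∞ f (𝒢.e (𝒢.s γ)))
    (hfs : ∀ᶠ h in 𝓝 (𝒢.e (𝒢.s γ)), 𝒢.s (f h) = 𝒢.s h ∧
      ∀ k, 𝒢.t k = 𝒢.s h → 𝒢.mul (f h) k = f (𝒢.mul h k)) :
    ∀ᶠ h in 𝓝 (𝒢.e (𝒢.s γ)), mfderiv 𝓘(ℝ, EG) 𝓘(ℝ, EG) f h (𝒢.leftInvariant σ h) =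
      𝒢.leftInvariant σ (f h) := by
  filter_upwards [hfs, (contMDiffAt_iff_contMDiffAt_nhds (by simp)).1
    (ContMDiffAt.of_le hf (m := 1) (by simp))] with h hh hf1
  obtain ⟨f', hf', hfh, hfm', -⟩ := 𝒢.exists_leftTranslation h
  have hfd : MDifferentiableAt 𝓘(ℝ, EG) 𝓘(ℝ, EG) f h := hf1.mdifferentiableAt one_ne_zero
  have hf'd := hf'.mdifferentiableAt (by simp)
  have hfd' : MDifferentiableAt 𝓘(ℝ, EG) 𝓘(ℝ, EG) f (f' (𝒢.e (𝒢.s h))) := by rwa [hfh]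
  have h1 := leftInvariant_eq_mfderiv σ hh.1 (f := f ∘ f') (hfd'.comp _ hf'd)
    (hfm'.mono fun k hk hk' => by rw [Function.comp_apply, hk hk', hh.2 k hk'])
  have h2 := leftInvariant_eq_mfderiv σ rfl hf'd hfm'
  have h3 := mfderiv_comp_apply (g := f) (f := f') (𝒢.e (𝒢.s h)) hfd' hf'd (σ (𝒢.s h))
  have h4 : (mfderiv 𝓘(ℝ, EG) 𝓘(ℝ, EG) f h : EG →L[ℝ] EG) =
      mfderiv 𝓘(ℝ, EG) 𝓘(ℝ, EG) f (f' (𝒢.e (𝒢.s h))) := by rw [hfh]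
  refine Eq.trans ?_ (h1.trans h3).symm
  exact (congrArg (fun A : EG →L[ℝ] EG => A (𝒢.leftInvariant σ h)) h4).trans
    (congrArg (mfderiv 𝓘(ℝ, EG) 𝓘(ℝ, EG) f (f' (𝒢.e (𝒢.s h))) : EG →L[ℝ] EG) h2)

variable [IsManifold 𝓘(ℝ, EM) ∞ M] [FiniteDimensional ℝ EM]

/-- The inclusion of the Lie algebroid into the tangent bundle of the groupoid. -/
theorem contMDiff_inclusion (𝒢 : LieGroupoid EM EG M G) :
    ContMDiff (𝓘(ℝ, EM).prod 𝓘(ℝ, AlgebroidModel EM EG)) 𝓘(ℝ, EG).tangent ∞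
      (fun v : TotalSpace (AlgebroidModel EM EG) 𝒢.AlgebroidFiber =>
        (⟨𝒢.e v.1, v.2⟩ : TangentBundle 𝓘(ℝ, EG) G)) := by
  intro v₀
  have hproj : ContMDiffAt (𝓘(ℝ, EM).prod 𝓘(ℝ, AlgebroidModel EM EG)) 𝓘(ℝ, EM) ∞
      (fun v : TotalSpace (AlgebroidModel EM EG) 𝒢.AlgebroidFiber => v.1) v₀ :=
    (contMDiffAt_totalSpace.1 contMDiffAt_id).1
  have hcoord : ContMDiffAt (𝓘(ℝ, EM).prod 𝓘(ℝ, AlgebroidModel EM EG))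
      𝓘(ℝ, AlgebroidModel EM EG) ∞
      (fun v : TotalSpace (AlgebroidModel EM EG) 𝒢.AlgebroidFiber =>
        𝒢.fiberCoord v₀.1 v.1 v.2) v₀ :=
    (contMDiffAt_totalSpace.1 contMDiffAt_id).2
  refine contMDiffAt_totalSpace.2 ⟨(𝒢.contMDiff_e _).comp v₀ hproj, ?_⟩
  have h2 : ContMDiffAt 𝓘(ℝ, EM) 𝓘(ℝ, EM × AlgebroidModel EM EG →L[ℝ] EG) ∞
      (fun x => (𝒢.splitT v₀.1 x).inverse) v₀.1 := by
    obtain ⟨E, hE⟩ := (𝒢.mem_trivDomain v₀.1).2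
    have := contDiffAt_map_inverse (n := ∞) E
    rw [hE] at this
    exact this.contMDiffAt.comp v₀.1 ((𝒢.contMDiffOn_splitT v₀.1).contMDiffAt
      ((𝒢.isOpen_domT v₀.1).mem_nhds (𝒢.mem_domT v₀.1)))
  have h3 := ((h2.comp v₀ hproj).clm_comp (contMDiffAt_const
    (c := ContinuousLinearMap.inr ℝ EM (AlgebroidModel EM EG)))).clm_apply hcoord
  refine h3.congr_of_eventuallyEq ?_
  filter_upwards [hproj.continuousAt.eventually
    ((𝒢.isOpen_trivDomain v₀.1).mem_nhds (𝒢.mem_trivDomain v₀.1))] with v hv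
  have h4 := congrArg ((𝒢.trivG v₀.1).continuousLinearMapAt ℝ (𝒢.e v.1))
    (𝒢.fiberVec_fiberCoord hv v.2)
  refine (Trivialization.continuousLinearMapAt_apply_of_mem (R := ℝ) _ hv.1.2 _).symm.trans
    (h4.symm.trans ?_)
  exact Trivialization.continuousLinearMapAt_symmL _ hv.1.2 _

theorem smoothFieldAt_leftInvariant {σ : ∀ x, 𝒢.AlgebroidFiber x} {γ₀ : G}
    (hσ : ContMDiffAt 𝓘(ℝ, EM) (𝓘(ℝ, EM).prod 𝓘(ℝ, AlgebroidModel EM EG)) ∞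
      (fun x => TotalSpace.mk' (AlgebroidModel EM EG) x (σ x)) (𝒢.s γ₀)) :
    SmoothFieldAt (𝒢.leftInvariant σ) γ₀ := by
  obtain ⟨μ, hμ, hμm, -⟩ := 𝒢.exists_local_mul γ₀
  refine ContMDiffAt.congr_of_eventuallyEq ?_ (leftInvariant_eventuallyEq σ hμ hμm)
  have h1 := (𝒢.contMDiff_inclusion _).comp γ₀ (hσ.comp γ₀ (𝒢.contMDiff_s γ₀))
  exact ContMDiffAt.mfderiv_apply_field (b := fun γ => 𝒢.e (𝒢.s γ)) hμ h1

theorem diffFieldAt_leftInvariant {σ : ∀ x, 𝒢.AlgebroidFiber x} {γ₀ : G}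
    (hσ : MDifferentiableAt 𝓘(ℝ, EM) (𝓘(ℝ, EM).prod 𝓘(ℝ, AlgebroidModel EM EG))
      (fun x => TotalSpace.mk' (AlgebroidModel EM EG) x (σ x)) (𝒢.s γ₀)) :
    DiffFieldAt (𝒢.leftInvariant σ) γ₀ := by
  obtain ⟨μ, hμ, hμm, -⟩ := 𝒢.exists_local_mul γ₀
  refine MDifferentiableAt.congr_of_eventuallyEq ?_ (leftInvariant_eventuallyEq σ hμ hμm)
  have h1 := ((𝒢.contMDiff_inclusion _).mdifferentiableAt (by simp)).comp γ₀
    (hσ.comp γ₀ ((𝒢.contMDiff_s γ₀).mdifferentiableAt (by simp)))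
  exact MDifferentiableAt.mfderiv_apply_field (b := fun γ => 𝒢.e (𝒢.s γ)) hμ
    ((𝒢.contMDiff_e _).comp γ₀ (𝒢.contMDiff_s γ₀)) h1

/-! ### The Lie algebroid of a Lie groupoid -/

variable (𝒢)

omit [IsManifold 𝓘(ℝ, EM) ∞ M] [IsManifold 𝓘(ℝ, EG) ∞ G] [FiniteDimensional ℝ EM]
  [FiniteDimensional ℝ EG] in
theorem leftInvariant_add (σ τ : ∀ x, 𝒢.AlgebroidFiber x) :
    𝒢.leftInvariant (σ + τ) = 𝒢.leftInvariant σ + 𝒢.leftInvariant τ :=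
  funext fun γ => map_add (mfderivWithin 𝓘(ℝ, EG) 𝓘(ℝ, EG) (𝒢.mul γ) {h | 𝒢.t h = 𝒢.s γ}
    (𝒢.e (𝒢.s γ)) : EG →L[ℝ] EG) (σ (𝒢.s γ)).1 (τ (𝒢.s γ)).1

omit [IsManifold 𝓘(ℝ, EM) ∞ M] [IsManifold 𝓘(ℝ, EG) ∞ G] [FiniteDimensional ℝ EM]
  [FiniteDimensional ℝ EG] in
theorem leftInvariant_smul (f : M → ℝ) (σ : ∀ x, 𝒢.AlgebroidFiber x) :
    𝒢.leftInvariant (f • σ) = (f ∘ 𝒢.s) • 𝒢.leftInvariant σ :=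
  funext fun γ => map_smul (mfderivWithin 𝓘(ℝ, EG) 𝓘(ℝ, EG) (𝒢.mul γ) {h | 𝒢.t h = 𝒢.s γ}
    (𝒢.e (𝒢.s γ)) : EG →L[ℝ] EG) (f (𝒢.s γ)) (σ (𝒢.s γ)).1

omit [IsManifold 𝓘(ℝ, EM) ∞ M] [IsManifold 𝓘(ℝ, EG) ∞ G] [FiniteDimensional ℝ EM]
  [FiniteDimensional ℝ EG] in
theorem leftInvariant_const_smul (c : ℝ) (σ : ∀ x, 𝒢.AlgebroidFiber x) :
    𝒢.leftInvariant (c • σ) = c • 𝒢.leftInvariant σ :=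
  funext fun γ => map_smul (mfderivWithin 𝓘(ℝ, EG) 𝓘(ℝ, EG) (𝒢.mul γ) {h | 𝒢.t h = 𝒢.s γ}
    (𝒢.e (𝒢.s γ)) : EG →L[ℝ] EG) c (σ (𝒢.s γ)).1

/-- The anchor of the Lie algebroid of a Lie groupoid: the restriction of `ds`. -/
def anchor (x : M) : 𝒢.AlgebroidFiber x →L[ℝ] TangentSpace 𝓘(ℝ, EM) x :=
  (mfderiv 𝓘(ℝ, EG) 𝓘(ℝ, EM) 𝒢.s (𝒢.e x)).comp (Submodule.subtypeL (𝒢.kerT x))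

omit [IsManifold 𝓘(ℝ, EM) ∞ M] [IsManifold 𝓘(ℝ, EG) ∞ G] [FiniteDimensional ℝ EM]
  [FiniteDimensional ℝ EG] in
theorem anchor_apply (x : M) (v : 𝒢.AlgebroidFiber x) :
    𝒢.anchor x v = mfderiv 𝓘(ℝ, EG) 𝓘(ℝ, EM) 𝒢.s (𝒢.e x) (v : TangentSpace 𝓘(ℝ, EG) (𝒢.e x)) :=
  rfl

theorem contMDiff_anchor : ContMDiff (𝓘(ℝ, EM).prod 𝓘(ℝ, AlgebroidModel EM EG))
    (𝓘(ℝ, EM).prod 𝓘(ℝ, EM)) ∞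
    (fun v : TotalSpace (AlgebroidModel EM EG) 𝒢.AlgebroidFiber =>
      (⟨v.proj, 𝒢.anchor v.proj v.2⟩ : TangentBundle 𝓘(ℝ, EM) M)) := by
  refine ((𝒢.contMDiff_s.contMDiff_tangentMap (m := ∞) le_rfl).comp
    𝒢.contMDiff_inclusion).congr fun v => ?_
  exact tangentBundle_mk_eq (𝒢.s_e v.1).symm rfl

variable {𝒢} in
omit [IsManifold 𝓘(ℝ, EM) ∞ M] [FiniteDimensional ℝ EM] in
theorem mfderiv_s_leftInvariant_eq_anchor (σ : ∀ x, 𝒢.AlgebroidFiber x) (γ : G) :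
    mfderiv 𝓘(ℝ, EG) 𝓘(ℝ, EM) 𝒢.s γ (𝒢.leftInvariant σ γ) =
      𝒢.anchor (𝒢.s γ) (σ (𝒢.s γ)) :=
  mfderiv_s_leftInvariant σ γ

/-- The smooth sections of the Lie algebroid of `𝒢`. -/
abbrev Section : Type _ := Cₛ^∞⟮𝓘(ℝ, EM); AlgebroidModel EM EG, 𝒢.AlgebroidFiber⟯

variable {𝒢}

theorem Section.smoothFieldAt (σ : 𝒢.Section) (γ : G) : SmoothFieldAt (𝒢.leftInvariant σ) γ :=
  smoothFieldAt_leftInvariant (σ.contMDiff _)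

theorem Section.diffFieldAt (σ : 𝒢.Section) (γ : G) : DiffFieldAt (𝒢.leftInvariant σ) γ :=
  (σ.smoothFieldAt γ).diffFieldAt

/-- The Lie bracket of left invariant fields is tangent to the `t`-fibres, since both fields are
`t`-related to zero. -/
theorem mlieBracket_leftInvariant_mem (σ τ : 𝒢.Section) (x : M) :
    mlieBracket 𝓘(ℝ, EG) (𝒢.leftInvariant σ) (𝒢.leftInvariant τ) (𝒢.e x) ∈ 𝒢.kerT x := by
  have h0 : DiffFieldAt (0 : ∀ b : M, TangentSpace 𝓘(ℝ, EM) b) (𝒢.t (𝒢.e x)) :=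
    (contMDiff_zeroSection ℝ (TangentSpace 𝓘(ℝ, EM) : M → Type _) (n := 1)
      (IB := 𝓘(ℝ, EM)) (F := EM)).contMDiffAt.mdifferentiableAt one_ne_zero
  have h := mfderiv_mlieBracket_of_related (𝒢.contMDiff_t (𝒢.e x)) (σ.diffFieldAt _)
    (τ.diffFieldAt _) h0 h0 (Filter.Eventually.of_forall (mfderiv_t_leftInvariant σ))
    (Filter.Eventually.of_forall (mfderiv_t_leftInvariant τ))
  rw [mlieBracket_zero_left] at h
  exact h

/-- The bracket of two smooth sections of the Lie algebroid of `𝒢`: the value at the units of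
the Lie bracket of the left invariant fields. -/
def sectionBracket (σ τ : 𝒢.Section) : 𝒢.Section where
  toFun x := ⟨mlieBracket 𝓘(ℝ, EG) (𝒢.leftInvariant σ) (𝒢.leftInvariant τ) (𝒢.e x),
    mlieBracket_leftInvariant_mem σ τ x⟩
  contMDiff_toFun := by
    have : CompleteSpace EG := FiniteDimensional.complete ℝ EG
    refine (𝒢.contMDiff_section_iff _).2 fun x => ?_
    exact ((σ.smoothFieldAt (𝒢.e x)).mlieBracket (τ.smoothFieldAt _)).comp x (𝒢.contMDiff_e x)

theorem sectionBracket_apply (σ τ : 𝒢.Section) (x : M) :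
    (sectionBracket σ τ x : TangentSpace 𝓘(ℝ, EG) (𝒢.e x)) =
      mlieBracket 𝓘(ℝ, EG) (𝒢.leftInvariant σ) (𝒢.leftInvariant τ) (𝒢.e x) := rfl

/-- The Lie bracket of left invariant fields is left invariant: the extended left translations
preserve the fields near a unit, and hence their bracket at the unit. -/
theorem leftInvariant_sectionBracket (σ τ : 𝒢.Section) :
    𝒢.leftInvariant (sectionBracket σ τ) =
      mlieBracket 𝓘(ℝ, EG) (𝒢.leftInvariant σ) (𝒢.leftInvariant τ) := by
  funext γ
  obtain ⟨f, hf, hfγ, hfm, hfs⟩ := 𝒢.exists_leftTranslation γ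
  have h1 := leftInvariant_eq_mfderiv (sectionBracket σ τ) rfl (hf.mdifferentiableAt (by simp)) hfm
  have h2 := mfderiv_mlieBracket_of_related hf (σ.diffFieldAt _) (τ.diffFieldAt _)
    (σ.diffFieldAt _) (τ.diffFieldAt _) (eventually_mfderiv_leftTranslation σ hf hfs)
    (eventually_mfderiv_leftTranslation τ hf hfs)
  have h3 : (mlieBracket 𝓘(ℝ, EG) (𝒢.leftInvariant σ) (𝒢.leftInvariant τ)
      (f (𝒢.e (𝒢.s γ))) : EG) =
      mlieBracket 𝓘(ℝ, EG) (𝒢.leftInvariant σ) (𝒢.leftInvariant τ) γ := by rw [hfγ]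
  exact h1.trans (Eq.trans h2 h3)

variable (𝒢) in
/-- The Lie algebroid of a Lie groupoid. -/
def lieAlgebroid : LieAlgebroid EM (AlgebroidModel EM EG) 𝒢.AlgebroidFiber :=
  haveI : CompleteSpace EG := FiniteDimensional.complete ℝ EG
  { anchor := 𝒢.anchor
    contMDiff_anchor := 𝒢.contMDiff_anchor
    bracket := LinearMap.mk₂ ℝ sectionBracket
      (fun (σ σ' τ : 𝒢.Section) => by
        ext x
        have h := 𝒢.leftInvariant_add σ σ'
        rw [sectionBracket_apply, ContMDiffSection.coe_add, h,
          mlieBracket_add_left (σ.diffFieldAt _) (σ'.diffFieldAt _)]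
        rfl)
      (fun c (σ τ : 𝒢.Section) => by
        ext x
        rw [sectionBracket_apply, ContMDiffSection.coe_smul, leftInvariant_const_smul,
          mlieBracket_const_smul_left (σ.diffFieldAt _)]
        rfl)
      (fun (σ τ τ' : 𝒢.Section) => by
        ext x
        rw [sectionBracket_apply, ContMDiffSection.coe_add, leftInvariant_add,
          mlieBracket_add_right (τ.diffFieldAt _) (τ'.diffFieldAt _)]
        rfl)
      (fun c (σ τ : 𝒢.Section) => by
        ext x
        rw [sectionBracket_apply, ContMDiffSection.coe_smul, leftInvariant_const_smul,
          mlieBracket_const_smul_right (τ.diffFieldAt _)]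
        rfl)
    bracket_self := fun (σ : 𝒢.Section) => by
      ext x
      change mlieBracket 𝓘(ℝ, EG) (𝒢.leftInvariant σ) (𝒢.leftInvariant σ) (𝒢.e x) = 0
      rw [mlieBracket_self]
      rfl
    jacobi := fun (σ τ υ : 𝒢.Section) => by
      have : IsManifold 𝓘(ℝ, EG) (minSmoothness ℝ 3) G := by
        rw [minSmoothness_of_isRCLikeNormedField]; infer_instance
      have h2 : minSmoothness ℝ 2 ≤ (∞ : WithTop ℕ∞) := by
        rw [minSmoothness_of_isRCLikeNormedField]; exact ENat.LEInfty.out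
      ext x
      change mlieBracket 𝓘(ℝ, EG) (𝒢.leftInvariant σ)
          (𝒢.leftInvariant (sectionBracket τ υ)) (𝒢.e x) =
        mlieBracket 𝓘(ℝ, EG) (𝒢.leftInvariant (sectionBracket σ τ)) (𝒢.leftInvariant υ) (𝒢.e x) +
        mlieBracket 𝓘(ℝ, EG) (𝒢.leftInvariant τ) (𝒢.leftInvariant (sectionBracket σ υ)) (𝒢.e x)
      rw [leftInvariant_sectionBracket, leftInvariant_sectionBracket, leftInvariant_sectionBracket]
      exact leibniz_identity_mlieBracket_apply ((σ.smoothFieldAt _).of_le h2)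
        ((τ.smoothFieldAt _).of_le h2) ((υ.smoothFieldAt _).of_le h2)
    leibniz := fun (σ τ τ' : 𝒢.Section) f hf hτ' x => by
      have e : (τ' : ∀ x, 𝒢.AlgebroidFiber x) = f • (τ : ∀ x, 𝒢.AlgebroidFiber x) := funext hτ'
      have hfd : MDifferentiableAt 𝓘(ℝ, EM) 𝓘(ℝ, ℝ) f (𝒢.s (𝒢.e x)) :=
        (hf _).mdifferentiableAt (by simp)
      have hs := (𝒢.contMDiff_s (𝒢.e x)).mdifferentiableAt (by simp)
      refine Subtype.ext ?_
      change mlieBracket 𝓘(ℝ, EG) (𝒢.leftInvariant σ) (𝒢.leftInvariant τ') (𝒢.e x) =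
        f x • mlieBracket 𝓘(ℝ, EG) (𝒢.leftInvariant σ) (𝒢.leftInvariant τ) (𝒢.e x) +
          mvfderiv 𝓘(ℝ, EM) f x (𝒢.anchor x (σ x)) • (τ x : TangentSpace 𝓘(ℝ, EG) (𝒢.e x))
      rw [e, leftInvariant_smul, mlieBracket_smul_right (hfd.comp _ hs) (τ.diffFieldAt _), add_comm,
        mvfderiv_comp_apply _ hfd hs, leftInvariant_unit, leftInvariant_unit, Function.comp_apply]
      have e2 : (mvfderiv 𝓘(ℝ, EM) f (𝒢.s (𝒢.e x)) : EM →L[ℝ] ℝ) = mvfderiv 𝓘(ℝ, EM) f x := by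
        rw [𝒢.s_e]
      have e3 : mvfderiv 𝓘(ℝ, EM) f (𝒢.s (𝒢.e x)) (mfderiv 𝓘(ℝ, EG) 𝓘(ℝ, EM) 𝒢.s (𝒢.e x) (σ x)) =
        mvfderiv 𝓘(ℝ, EM) f x (𝒢.anchor x (σ x)) :=
        congrArg (fun A : EM →L[ℝ] ℝ => A (𝒢.anchor x (σ x))) e2
      rw [e3, 𝒢.s_e] }

theorem isLieAlgebroidOf_lieAlgebroid : 𝒢.IsLieAlgebroidOf 𝒢.lieAlgebroid where
  anchor_eq _ _ := rfl
  leftInvariant_bracket := leftInvariant_sectionBracket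

/-! ### The connection -/

variable (𝒢) (η : SmoothMetric EG G) (g : SmoothMetric EM M)


/-- The lift at the unit `e x` of a tangent vector of `M` at `x` that is horizontal for the
source map: `η (lift u) v = g u (ds v)` for all `v`. -/
def unitLift (x : M) : TangentSpace 𝓘(ℝ, EM) x →ₗ[ℝ] TangentSpace 𝓘(ℝ, EG) (𝒢.e x) where
  toFun u := η.horizontalLift g 𝒢.s (𝒢.e x) u
  map_add' _ _ := η.horizontalLift_add g 𝒢.s _ _ _
  map_smul' _ _ := η.horizontalLift_smul g 𝒢.s _ _ _

omit [FiniteDimensional ℝ EM] in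
theorem inner_unitLift (x : M) (u : TangentSpace 𝓘(ℝ, EM) x)
    (v : TangentSpace 𝓘(ℝ, EG) (𝒢.e x)) :
    η.inner (𝒢.e x) (𝒢.unitLift η g x u) v =
      g.inner x u (mfderiv 𝓘(ℝ, EG) 𝓘(ℝ, EM) 𝒢.s (𝒢.e x) v) := by
  refine (η.inner_horizontalLift g 𝒢.s (𝒢.e x) u v).trans ?_
  have h : (g.inner (𝒢.s (𝒢.e x)) : EM →L[ℝ] EM →L[ℝ] ℝ) = g.inner x := by rw [𝒢.s_e]
  exact congrArg (fun A : EM →L[ℝ] EM →L[ℝ] ℝ =>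
    A u (mfderiv 𝓘(ℝ, EG) 𝓘(ℝ, EM) 𝒢.s (𝒢.e x) v)) h

omit [FiniteDimensional ℝ EM] in
theorem unitLift_field (X : ∀ x : M, TangentSpace 𝓘(ℝ, EM) x) (x : M) :
    𝒢.unitLift η g x (X x) = η.horizontalLift g 𝒢.s (𝒢.e x) (X (𝒢.s (𝒢.e x))) := by
  have h : (X (𝒢.s (𝒢.e x)) : EM) = X x := by rw [𝒢.s_e]
  exact congrArg (fun u : EM => η.horizontalLift g 𝒢.s (𝒢.e x) u) h.symm

/-- The adjoint of the anchor: `η (adjoint u) w = g u (ρ w)` for all `w` in the fibre of the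
Lie algebroid. -/
def anchorAdjoint (x : M) : TangentSpace 𝓘(ℝ, EM) x →ₗ[ℝ] 𝒢.AlgebroidFiber x :=
  (η.represent (𝒢.kerT x)).comp
    (LinearMap.mk₂ ℝ (fun u w => g.inner x u (𝒢.anchor x w)) (by simp) (by simp) (by simp)
      (by simp))

omit [FiniteDimensional ℝ EM] in
theorem inner_anchorAdjoint (x : M) (u : TangentSpace 𝓘(ℝ, EM) x) (w : 𝒢.AlgebroidFiber x) :
    η.inner (𝒢.e x) (𝒢.anchorAdjoint η g x u) w = g.inner x u (𝒢.anchor x w) :=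
  η.inner_represent (𝒢.kerT x) _ w

/-- The functional `w ↦ (L_V η)(w, uʰ) - η (∇_w V) (ρ* u)` on the fibre of the Lie algebroid, where
`V` is the left invariant field of `σ`, `uʰ` the horizontal lift of `u`, `ρ*` the adjoint of the
anchor, `∇` the Levi-Civita connection of `η`, and `L_V η` is written as the symmetrization of
`η (∇ V)`. -/
def connectionForm (σ : ∀ x, 𝒢.AlgebroidFiber x) (x : M) :
    TangentSpace 𝓘(ℝ, EM) x →ₗ[ℝ] Module.Dual ℝ (𝒢.AlgebroidFiber x) :=
  LinearMap.mk₂ ℝ (fun u w =>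
    η.koszulForm (𝒢.leftInvariant σ) (𝒢.e x) w (𝒢.unitLift η g x u) +
      η.koszulForm (𝒢.leftInvariant σ) (𝒢.e x) (𝒢.unitLift η g x u) w -
      η.koszulForm (𝒢.leftInvariant σ) (𝒢.e x) w (𝒢.anchorAdjoint η g x u))
    (fun _ _ _ => by simp; ring) (fun _ _ _ => by simp; ring) (fun _ _ _ => by simp; ring)
    (fun _ _ _ => by simp; ring)

/-- The connection on the Lie algebroid: `η (∇_u σ) w` is the value of `connectionForm`. -/
def connection (σ : ∀ x, 𝒢.AlgebroidFiber x) (x : M) :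
    TangentSpace 𝓘(ℝ, EM) x →L[ℝ] 𝒢.AlgebroidFiber x :=
  haveI : T2Space (TangentSpace 𝓘(ℝ, EM) x) := inferInstanceAs (T2Space EM)
  LinearMap.toContinuousLinearMap
    ((η.represent (𝒢.kerT x)).comp (𝒢.connectionForm η g σ x))

theorem inner_connection (σ : ∀ x, 𝒢.AlgebroidFiber x) (x : M) (u : TangentSpace 𝓘(ℝ, EM) x)
    (w : 𝒢.AlgebroidFiber x) :
    η.inner (𝒢.e x) (𝒢.connection η g σ x u) w =
      η.koszulForm (𝒢.leftInvariant σ) (𝒢.e x) w (𝒢.unitLift η g x u) +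
        η.koszulForm (𝒢.leftInvariant σ) (𝒢.e x) (𝒢.unitLift η g x u) w -
        η.koszulForm (𝒢.leftInvariant σ) (𝒢.e x) w (𝒢.anchorAdjoint η g x u) :=
  η.inner_represent (𝒢.kerT x) _ w

variable {𝒢 η g}

theorem diffFieldAt_leftInvariant_unit {σ : ∀ x, 𝒢.AlgebroidFiber x} {x : M}
    (hσ : MDifferentiableAt 𝓘(ℝ, EM) (𝓘(ℝ, EM).prod 𝓘(ℝ, AlgebroidModel EM EG))
      (fun x => TotalSpace.mk' (AlgebroidModel EM EG) x (σ x)) x) :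
    DiffFieldAt (𝒢.leftInvariant σ) (𝒢.e x) :=
  diffFieldAt_leftInvariant (by rwa [𝒢.s_e])

theorem mfderiv_s_unitLift (hs : IsRiemannianSubmersion η g 𝒢.s) (x : M)
    (u : TangentSpace 𝓘(ℝ, EM) x) :
    mfderiv 𝓘(ℝ, EG) 𝓘(ℝ, EM) 𝒢.s (𝒢.e x) (𝒢.unitLift η g x u) = u :=
  hs.mfderiv_horizontalLift (𝒢.e x) u

theorem connection_add {σ τ : ∀ x, 𝒢.AlgebroidFiber x} {x : M}
    (hσ : DiffFieldAt (𝒢.leftInvariant σ) (𝒢.e x))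
    (hτ : DiffFieldAt (𝒢.leftInvariant τ) (𝒢.e x)) :
    𝒢.connection η g (σ + τ) x = 𝒢.connection η g σ x + 𝒢.connection η g τ x := by
  ext1 u
  refine η.eq_of_inner_eq_on fun w => ?_
  rw [add_apply, Submodule.coe_add, map_add, add_apply]
  simp only [inner_connection, leftInvariant_add, η.koszulForm_add hσ hτ]
  ring

/-- The Leibniz rule. Since `η (σ, uʰ) = g (u, ρ σ) = η (σ, ρ* u)`, the terms with the derivative of
`f` along `ρ w` cancel, and the one with its derivative along `ds uʰ = u` remains. -/
theorem connection_smul (hs : IsRiemannianSubmersion η g 𝒢.s) {σ : ∀ x, 𝒢.AlgebroidFiber x}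
    {f : M → ℝ} {x : M} (hf : MDifferentiableAt 𝓘(ℝ, EM) 𝓘(ℝ, ℝ) f x)
    (hσ : DiffFieldAt (𝒢.leftInvariant σ) (𝒢.e x)) :
    𝒢.connection η g (f • σ) x =
      f x • 𝒢.connection η g σ x + (mvfderiv 𝓘(ℝ, EM) f x).smulRight (σ x) := by
  ext1 u
  refine η.eq_of_inner_eq_on fun w => ?_
  have hse := 𝒢.s_e x
  have hf' : MDifferentiableAt 𝓘(ℝ, EM) 𝓘(ℝ, ℝ) f (𝒢.s (𝒢.e x)) := by rwa [hse]
  have hsd := (𝒢.contMDiff_s (𝒢.e x)).mdifferentiableAt (by simp)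
  have hd : ∀ z, mvfderiv 𝓘(ℝ, EG) (f ∘ 𝒢.s) (𝒢.e x) z =
      mvfderiv 𝓘(ℝ, EM) f x (mfderiv 𝓘(ℝ, EG) 𝓘(ℝ, EM) 𝒢.s (𝒢.e x) z) := by
    intro z
    rw [mvfderiv_comp_apply _ hf' hsd]
    have e2 : (mvfderiv 𝓘(ℝ, EM) f (𝒢.s (𝒢.e x)) : EM →L[ℝ] ℝ) = mvfderiv 𝓘(ℝ, EM) f x := by
      rw [𝒢.s_e]
    exact congrArg (fun A : EM →L[ℝ] ℝ => A (mfderiv 𝓘(ℝ, EG) 𝓘(ℝ, EM) 𝒢.s (𝒢.e x) z)) e2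
  have e1 : η.inner (𝒢.e x) (σ x) (𝒢.unitLift η g x u) = g.inner x u (𝒢.anchor x (σ x)) := by
    rw [η.symm, inner_unitLift, anchor_apply]
  have e2 : η.inner (𝒢.e x) (σ x) (𝒢.anchorAdjoint η g x u) =
      g.inner x u (𝒢.anchor x (σ x)) := by
    rw [η.symm, inner_anchorAdjoint]
  rw [inner_connection, leftInvariant_smul]
  simp only [η.koszulForm_smul (hf'.comp _ hsd) hσ, leftInvariant_unit, hd, e1, e2,
    mfderiv_s_unitLift hs, Function.comp_apply, hse]
  rw [add_apply, smul_apply, ContinuousLinearMap.smulRight_apply, Submodule.coe_add,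
    Submodule.coe_smul, Submodule.coe_smul, map_add, map_smul, map_smul, add_apply, smul_apply,
    smul_apply, inner_connection]
  simp only [smul_eq_mul]
  ring

/-- The connection on the Lie algebroid as a bundled covariant derivative. -/
def covariantDerivative (hs : IsRiemannianSubmersion η g 𝒢.s) :
    CovariantDerivative 𝓘(ℝ, EM) (AlgebroidModel EM EG) 𝒢.AlgebroidFiber where
  toFun := 𝒢.connection η g
  isCovariantDerivativeOnUniv :=
    { add := fun hσ hτ _ => connection_add (diffFieldAt_leftInvariant_unit hσ)
        (diffFieldAt_leftInvariant_unit hτ)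
      leibniz := fun hσ hf _ => connection_smul hs hf (diffFieldAt_leftInvariant_unit hσ) }

variable (𝒢 η) in
/-- The metric `η` restricted to the fibres of the Lie algebroid. -/
def fiberMetric (x : M) : 𝒢.AlgebroidFiber x →L[ℝ] 𝒢.AlgebroidFiber x →L[ℝ] ℝ :=
  (ContinuousLinearMap.precomp ℝ (Submodule.subtypeL (𝒢.kerT x))).comp
    ((η.inner (𝒢.e x)).comp (Submodule.subtypeL (𝒢.kerT x)))

/-- Smoothness at a point of a section of the Lie algebroid. -/
abbrev SmoothSectionAt (σ : ∀ x, 𝒢.AlgebroidFiber x) (x : M) : Prop :=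
  ContMDiffAt 𝓘(ℝ, EM) (𝓘(ℝ, EM).prod 𝓘(ℝ, AlgebroidModel EM EG)) ∞
    (fun x => TotalSpace.mk' (AlgebroidModel EM EG) x (σ x)) x

theorem SmoothSectionAt.inclusion {σ : ∀ x, 𝒢.AlgebroidFiber x} {x : M}
    (hσ : SmoothSectionAt σ x) :
    ContMDiffAt 𝓘(ℝ, EM) 𝓘(ℝ, EG).tangent ∞
      (fun x => (⟨𝒢.e x, σ x⟩ : TangentBundle 𝓘(ℝ, EG) G)) x :=
  (𝒢.contMDiff_inclusion _).comp x hσ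

theorem SmoothSectionAt.anchor {σ : ∀ x, 𝒢.AlgebroidFiber x} {x : M}
    (hσ : SmoothSectionAt σ x) : SmoothFieldAt (fun y => 𝒢.anchor y (σ y)) x :=
  (𝒢.contMDiff_anchor _).comp x hσ

theorem smoothSectionAt_extend {x : M} (w : 𝒢.AlgebroidFiber x) :
    SmoothSectionAt (FiberBundle.extend (AlgebroidModel EM EG) w : ∀ x, 𝒢.AlgebroidFiber x) x :=
  FiberBundle.contMDiffAt_extend 𝓘(ℝ, EM) (AlgebroidModel EM EG) w

/-- A section of the Lie algebroid is smooth if its `η`-products with smooth sections are. -/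
theorem smoothSectionAt_of_inner (η : SmoothMetric EG G) {σ : ∀ x, 𝒢.AlgebroidFiber x} {x : M}
    (hσ : ∀ τ : ∀ x, 𝒢.AlgebroidFiber x, SmoothSectionAt τ x →
      ContMDiffAt 𝓘(ℝ, EM) 𝓘(ℝ, ℝ) ∞ (fun y => η.inner (𝒢.e y) (σ y) (τ y)) x) :
    SmoothSectionAt σ x := by
  refine contMDiffAt_section_of_bilin (Φ := 𝒢.fiberMetric η)
    (contMDiffAt_bilin_section fun v w => ?_) (fun v hv => ?_)
    fun w => hσ _ (smoothSectionAt_extend w)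
  · exact η.contMDiffAt_inner (smoothSectionAt_extend v).inclusion
      (smoothSectionAt_extend w).inclusion
  · exact Subtype.ext (η.eq_zero_of_inner _ (hv v))

theorem smoothSectionAt_anchorAdjoint {X : ∀ x : M, TangentSpace 𝓘(ℝ, EM) x} {x : M}
    (hX : SmoothFieldAt X x) : SmoothSectionAt (fun y => 𝒢.anchorAdjoint η g y (X y)) x := by
  refine smoothSectionAt_of_inner η fun τ hτ => ?_
  exact (g.contMDiffAt_inner hX hτ.anchor).congr_of_eventuallyEq
    (Filter.Eventually.of_forall fun y => 𝒢.inner_anchorAdjoint η g y _ _)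

omit [FiniteDimensional ℝ EM] in
theorem contMDiffAt_unitLift (hs : IsRiemannianSubmersion η g 𝒢.s)
    {X : ∀ x : M, TangentSpace 𝓘(ℝ, EM) x} {x : M} (hX : SmoothFieldAt X x) :
    ContMDiffAt 𝓘(ℝ, EM) 𝓘(ℝ, EG).tangent ∞
      (fun y => (⟨𝒢.e y, 𝒢.unitLift η g y (X y)⟩ : TangentBundle 𝓘(ℝ, EG) G)) x := by
  have hX' : SmoothFieldAt X (𝒢.s (𝒢.e x)) := by rwa [𝒢.s_e]
  refine ((hs.smoothFieldAt_horizontalLift hX').comp x (𝒢.contMDiff_e x)).congr_of_eventuallyEq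
    (Filter.Eventually.of_forall fun y => ?_)
  exact congrArg (fun v => (⟨𝒢.e y, v⟩ : TangentBundle 𝓘(ℝ, EG) G)) (𝒢.unitLift_field η g X y)

theorem smoothSectionAt_connection (hs : IsRiemannianSubmersion η g 𝒢.s)
    {σ : ∀ x, 𝒢.AlgebroidFiber x} {X : ∀ x : M, TangentSpace 𝓘(ℝ, EM) x} {x : M}
    (hσ : SmoothSectionAt σ x) (hX : SmoothFieldAt X x) :
    SmoothSectionAt (fun y => 𝒢.connection η g σ y (X y)) x := by
  refine smoothSectionAt_of_inner η fun τ hτ => ?_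
  have hV : SmoothFieldAt (𝒢.leftInvariant σ) (𝒢.e x) :=
    smoothFieldAt_leftInvariant (by rwa [𝒢.s_e])
  have hN := η.contMDiffAt_koszulForm hV
  have hτ' := hτ.inclusion
  have hXh := contMDiffAt_unitLift hs hX
  have hXa := (smoothSectionAt_anchorAdjoint (𝒢 := 𝒢) (η := η) (g := g) hX).inclusion
  exact (((ContMDiffAt.bilin_apply hN hτ' hXh).add (ContMDiffAt.bilin_apply hN hXh hτ')).sub
    (ContMDiffAt.bilin_apply hN hτ' hXa)).congr_of_eventuallyEq
    (Filter.Eventually.of_forall fun y => 𝒢.inner_connection η g σ y _ _)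

theorem contMDiff_covariantDerivative (hs : IsRiemannianSubmersion η g 𝒢.s) :
    (covariantDerivative hs).ContMDiffCovariantDerivative ∞ where
  contMDiff := ⟨fun {σ} hσ x _ => by
    have hσ' : SmoothSectionAt σ x := (hσ x (mem_univ x)).contMDiffAt Filter.univ_mem
    refine (contMDiffAt_hom_section (Φ := 𝒢.connection η g σ) fun u => ?_).contMDiffWithinAt
    exact smoothSectionAt_connection hs hσ' (smoothFieldAt_extend u)⟩

/-- The connection is compatible with the metric of `M`: the terms of `ᵗ∇ g` are values of the Lie
derivative of `η` on horizontal lifts and adjoints, and they combine to its value on the differences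
`uʰ - ρ* u`, which are horizontal for the target map. -/
theorem tauDerivMetric_covariantDerivative {g' : SmoothMetric EM M}
    (hs : IsRiemannianSubmersion η g 𝒢.s) (ht : IsRiemannianSubmersion η g' 𝒢.t)
    (σ : 𝒢.Section) {X Y : ∀ x : M, TangentSpace 𝓘(ℝ, EM) x} {x : M}
    (hX : SmoothFieldAt X x) (hY : SmoothFieldAt Y x) :
    𝒢.lieAlgebroid.tauDerivMetric (covariantDerivative hs) g σ X Y x = 0 := by
  set V := 𝒢.leftInvariant σ
  have hV : DiffFieldAt V (𝒢.e x) := σ.diffFieldAt _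
  have hX' : SmoothFieldAt X (𝒢.s (𝒢.e x)) := by rwa [𝒢.s_e]
  have hY' : SmoothFieldAt Y (𝒢.s (𝒢.e x)) := by rwa [𝒢.s_e]
  let v : ∀ x : M, TangentSpace 𝓘(ℝ, EM) x := fun y => 𝒢.anchor y (σ y)
  have hv : SmoothFieldAt v (𝒢.s (𝒢.e x)) := SmoothSectionAt.anchor (σ.contMDiff _)
  -- The source map turns the Lie derivative of `η` on horizontal lifts into that of `g`.
  have key := hs.koszulForm_horizontalLift hV hv.diffFieldAt
    (Filter.Eventually.of_forall (mfderiv_s_leftInvariant_eq_anchor σ)) hX' hY'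
  rw [← unitLift_field, ← unitLift_field] at key
  let D : M → ℝ := fun y => mvfderiv 𝓘(ℝ, EM) (fun b => g.inner b (X b) (Y b)) y (v y) -
    g.inner y (mlieBracket 𝓘(ℝ, EM) v X y) (Y y) - g.inner y (X y) (mlieBracket 𝓘(ℝ, EM) v Y y)
  have hD : D (𝒢.s (𝒢.e x)) = D x := by rw [𝒢.s_e]
  have key1 := key.trans hD
  -- The differences of horizontal lifts and adjoints are horizontal for the target map.
  have hor : ∀ u : TangentSpace 𝓘(ℝ, EM) x, ∀ w,
      mfderiv 𝓘(ℝ, EG) 𝓘(ℝ, EM) 𝒢.t (𝒢.e x) w = 0 →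
      η.inner (𝒢.e x) (𝒢.unitLift η g x u - 𝒢.anchorAdjoint η g x u) w = 0 := by
    intro u w hw
    have h1 := 𝒢.inner_unitLift η g x u w
    have h2 := 𝒢.inner_anchorAdjoint η g x u ⟨w, hw⟩
    rw [map_sub, sub_apply, h1, sub_eq_zero]
    exact h2.symm
  have key2 := ht.koszulForm_horizontal_of_vertical hV
    (Filter.Eventually.of_forall (mfderiv_t_leftInvariant σ)) _ _ (hor (X x)) (hor (Y x))
  simp only [map_sub, sub_apply] at key2
  have hcov : ∀ u w : TangentSpace 𝓘(ℝ, EM) x,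
      g.inner x w (𝒢.anchor x (𝒢.connection η g σ x u)) =
        η.koszulForm V (𝒢.e x) (𝒢.anchorAdjoint η g x w) (𝒢.unitLift η g x u) +
          η.koszulForm V (𝒢.e x) (𝒢.unitLift η g x u) (𝒢.anchorAdjoint η g x w) -
          η.koszulForm V (𝒢.e x) (𝒢.anchorAdjoint η g x w) (𝒢.anchorAdjoint η g x u) := by
    intro u w
    rw [← 𝒢.inner_anchorAdjoint η g x w, η.symm, inner_connection]
  have h1 := hcov (X x) (Y x)
  have h2 := hcov (Y x) (X x)
  change mvfderiv 𝓘(ℝ, EM) (fun b => g.inner b (X b) (Y b)) x (v x) -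
    g.inner x (mlieBracket 𝓘(ℝ, EM) v X x + 𝒢.anchor x (𝒢.connection η g σ x (X x))) (Y x) -
    g.inner x (X x) (mlieBracket 𝓘(ℝ, EM) v Y x + 𝒢.anchor x (𝒢.connection η g σ x (Y x))) = 0
  simp only [D] at key1
  rw [map_add, map_add, add_apply, h2, g.symm x (𝒢.anchor x _), h1]
  linear_combination key2 - key1

end LieGroupoid

end

theorem mainTheorem2 {EM EG M G : Type*}
    [NormedAddCommGroup EM] [NormedSpace ℝ EM] [FiniteDimensional ℝ EM]
    [NormedAddCommGroup EG] [NormedSpace ℝ EG] [FiniteDimensional ℝ EG]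
    [TopologicalSpace M] [ChartedSpace EM M] [IsManifold 𝓘(ℝ, EM) ∞ M]
    [T2Space M] [SecondCountableTopology M]
    [TopologicalSpace G] [ChartedSpace EG G] [IsManifold 𝓘(ℝ, EG) ∞ G]
    (𝒢 : LieGroupoid EM EG M G) (η : SmoothMetric EG G) (g g' : SmoothMetric EM M)
    (hs : IsRiemannianSubmersion η g 𝒢.s) (ht : IsRiemannianSubmersion η g' 𝒢.t) :
    ∃ 𝒜 : LieAlgebroid EM (LieGroupoid.AlgebroidModel EM EG) 𝒢.AlgebroidFiber,
      𝒢.IsLieAlgebroidOf 𝒜 ∧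
      ∃ cov : CovariantDerivative 𝓘(ℝ, EM) (LieGroupoid.AlgebroidModel EM EG) 𝒢.AlgebroidFiber,
        𝒜.IsKilling cov g :=
  ⟨𝒢.lieAlgebroid, LieGroupoid.isLieAlgebroidOf_lieAlgebroid, LieGroupoid.covariantDerivative hs,
    ⟨LieGroupoid.contMDiff_covariantDerivative hs, fun σ X Y x =>
      LieGroupoid.tauDerivMetric_covariantDerivative hs ht σ (X.contMDiff x) (Y.contMDiff x)⟩⟩
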